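/- **Language.** Fix arbitrary sets of individual constants and of predicate letters (with arities). There are infinitely many parameters (free variables), distinct from the bound variables. The terms are the constants and the parameters. The prime formulas are $Rt_1\ldots t_n$ ($R$ a predicate letter), $s=t$ and $\exists!t$; formulas are built from these and $\bot$ by $\land,\lor,\rightarrow,\forall,\exists$ ($\neg A$ is $A\rightarrow\bot$). **The system $\mathbf{INF}$** (intuitionist negative free logic) is natural deduction, with assumption classes and with vacuous discharge permitted, with the usual intuitionist introduction and elimination rules for $\land,\lor,\rightarrow$, the rule $(\bot E)$: from $\bot$ infer any $B$, and * $(\forall I)$: from a deduction of $A^x_a$, discharging assumptions $\exists!a$, infer $\forall xA$; $(\forall E)$: from $\forall xA$ and $\exists!t$ infer $A^x_t$; * $(\exists I)$: from $A^x_t$ and $\exists!t$ infer $\exists xA$; $(\exists E)$: from $\exists xA$ and a deduction of $C$, discharging assumptions $A^x_a$ and $\exists!a$, infer $C$; * $(=I^n)$: from $\exists!t$ infer $t=t$; $(=E)$: from $t_1=t_2$ and $A^x_{t_1}$ infer $A^x_{t_2}$; * $(AD)$: from $Rt_1\ldots t_n$, where $R$ is a predicate letter or $=$, infer $\exists!t_i$;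 with the usual restriction that in $(\forall I)$ and $(\exists E)$ the parameter $a$ belongs to that application alone. The leftmost premise of an elimination rule is its major premise; the others are minor. An application of $(=E)$ is vacuous if its minor premise and its conclusion are identical, in particular if its major premise is $t=t$. **Normal form.** A *segment* is a sequence of formula occurrences $C_1,\ldots,C_n$ in a deduction such that $C_1$ is not the conclusion of $(\lor E)$ or $(\exists E)$, $C_n$ is not a minor premise of $(\lor E)$ or $(\exists E)$, and for each $i<n$, $C_i$ is a minor premise of an application of $(\lor E)$ or $(\exists E)$ with conclusion $C_{i+1}$. It is premise of a rule if $C_n$ is, and conclusion of a rule if $C_1$ is. An *$(=E)$-segment* is a sequence of segments $\sigma_1,\ldots,\sigma_n$ such that each $\sigma_i$ ($i<n$) is the minor premise of an application of $(=E)$ with conclusion $\sigma_{i+1}$, $\sigma_1$ is minor premise but not conclusion of $(=E)$, and $\sigma_n$ is conclusion but not minor premise of $(=E)$. The maximal segments are: * maximal $I/E$-segments: segments whose last formula is the major premise of an elimination rule and which, if they have length $1$, are the conclusion of an introduction rule; * maximal $=$-segments: segments whose first formula is concluded by $(=I^n)$ and whose last is the premise of $(AD)$; * maximal $\exists!$-segments: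 segments whose first formula is concluded from some $t=t$ by $(AD)$ and whose last is the premise of $(=I^n)$; * maximal $(=E)$-segments: $(=E)$-segments whose last segment is the premise of $(AD)$, or on which all formulas have the form $\exists!t$. A deduction is in *normal form* if it contains no maximal segments. It is *restricted* if all its applications of $(=E)$ and $(\bot E)$ have prime conclusions. **Transformations.** The *restriction steps* replace, anywhere in a deduction, an application of $(=E)$ or $(\bot E)$ with a non-prime conclusion by applications to the immediate subformulas (for a conclusion $\exists xA$ of $(\bot E)$: to some $A^x_t$ and $\exists!t$), framed by eliminations and introductions; if the conclusion is $\bot$, the application is deleted. The *reduction steps* are, anywhere in a deduction: * the usual removal of a conclusion of an introduction rule that is the major premise of an elimination rule (for $\forall$, the deduction of $\exists!t$ is put on top of the discharged assumptions $\exists!a$ after $t$ is substituted for $a$; for $\exists$, likewise with the deductions of $A^x_t$ and of $\exists!t$); * the permutation of an elimination rule applied to the conclusion of $(\lor E)$ or $(\exists E)$ as major premise, or of $(AD)$ or $(=I^n)$ so applied, to the minor premises of $(\lor E)$ or $(\exists E)$; * the deletion of $(\lor E)$ with vacuous discharge in one of the minor premises, of $(\exists E)$ with wholly vacuous discharge,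 and of vacuous $(=E)$; * the replacement of $(=I^n)$ followed by $(AD)$, from $\exists!t$ to $t=t$ to $\exists!t$, and of $(AD)$ followed by $(=I^n)$, from $t=t$ to $\exists!t$ to $t=t$, by the deduction of the first formula; * the replacement of $(=E)$ from $s=t$ and $\exists!s$ to $\exists!t$ by $(AD)$ from $s=t$ to $\exists!t$; * the replacement of $(=E)$, with major premise $s=t$, followed by $(AD)$ with conclusion $\exists!w$, by $(AD)$ applied to $s=t$ if $w$ is $s$ or $t$, and applied to the minor premise otherwise. **Theorem.** Every deduction $D$ in $\mathbf{INF}$ of $A$ from open assumptions $\Gamma$ can be brought into normal form: by finitely many restriction steps $D$ is transformed into a restricted deduction $D_0$ of $A$ from $\Gamma$, and by finitely many reduction steps $D_0$ is transformed into a restricted deduction $D'$ of $A$ from (some of the formulas in) $\Gamma$ that contains no vacuous application of $(=E)$ and is in normal form. -/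

import Mathlib

/-! Intuitionist negative free logic: language, deductions, reduction procedures, normal form. -/

universe u v

namespace INF

/-- A first-order signature: individual constants, and predicate letters with their arities. -/
structure Sig where
  Const : Type u
  Pred : Type v
  arity : Pred → ℕ

/-! ### Terms and formulas

Formulas are identified up to renaming of bound variables by means of de Bruijn indices:
`var n` below `d` quantifiers is a bound variable if `n < d`, and is the parameter number `n - d`
otherwise.  So in a formula that does not stand below a quantifier, all `var n` that are not
captured are parameters; there are infinitely many of them. -/

/-- Terms (constants and variables). -/
inductive Tm (S : Sig.{u, v}) where
  | const (c : S.Const)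
  | var (n : ℕ)

/-- Formulas; `exi t` is `∃! t` (existence predicate). Negation is `A → ⊥`. -/
inductive Fml (S : Sig.{u, v}) where
  | rel (R : S.Pred) (ts : Fin (S.arity R) → Tm S)
  | eq (s t : Tm S)
  | exi (t : Tm S)
  | bot
  | and (A B : Fml S)
  | or (A B : Fml S)
  | imp (A B : Fml S)
  | all (A : Fml S)
  | ex (A : Fml S)

variable {S : Sig.{u, v}}

/-- Simultaneous substitution of terms for variables in a term. -/
def Tm.subst (σ : ℕ → Tm S) : Tm S → Tm S
  | .const c => .const c
  | .var n => σ n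

/-- The substitution that raises every parameter by one. -/
def shiftσ : ℕ → Tm S := fun n => .var (n + 1)

/-- `σ`, moved below a variable binder. -/
def upσ (σ : ℕ → Tm S) : ℕ → Tm S
  | 0 => .var 0
  | n + 1 => (σ n).subst shiftσ

/-- The substitution of `t` for variable `0`, lowering all other variables by one. -/
def instσ (t : Tm S) : ℕ → Tm S
  | 0 => t
  | n + 1 => .var n

/-- The substitution that exchanges the variables `0` and `1`. -/
def swapσ : ℕ → Tm S
  | 0 => .var 1
  | 1 => .var 0
  | n + 2 => .var (n + 2)

/-- Simultaneous (capture-avoiding) substitution of terms for parameters in a formula. -/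
def Fml.subst : (ℕ → Tm S) → Fml S → Fml S
  | σ, .rel R ts => .rel R (fun i => (ts i).subst σ)
  | σ, .eq s t => .eq (s.subst σ) (t.subst σ)
  | σ, .exi t => .exi (t.subst σ)
  | _, .bot => .bot
  | σ, .and A B => .and (A.subst σ) (B.subst σ)
  | σ, .or A B => .or (A.subst σ) (B.subst σ)
  | σ, .imp A B => .imp (A.subst σ) (B.subst σ)
  | σ, .all A => .all (A.subst (upσ σ))
  | σ, .ex A => .ex (A.subst (upσ σ))

/-- Raise all parameters by one, which makes parameter `0` fresh. -/
def Tm.shift (t : Tm S) : Tm S := t.subst shiftσ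

/-- Raise all parameters by one, which makes parameter `0` fresh. -/
def Fml.shift (A : Fml S) : Fml S := A.subst shiftσ

/-- `A.inst t` is `A` with `t` for the variable `x`, where `x` is variable `0` of `A`. -/
def Fml.inst (t : Tm S) (A : Fml S) : Fml S := A.subst (instσ t)

/-- Prime formulas: those formed from terms by predicate letters, `=` or `∃!`.  As there are no
complex terms, the atomic formulas are the same. `⊥` is not one of them. -/
inductive Fml.IsPrime : Fml S → Prop
  | rel (R : S.Pred) (ts : Fin (S.arity R) → Tm S) : IsPrime (.rel R ts)
  | eq (s t : Tm S) : IsPrime (.eq s t)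
  | exi (t : Tm S) : IsPrime (.exi t)

/-- `A.HasTerm t`: `A` is `R t₁ … tₙ`, with `R` a predicate letter or identity (but not `∃!`),
and `t` is one of `t₁, …, tₙ`. -/
inductive Fml.HasTerm : Fml S → Tm S → Prop
  | rel (R : S.Pred) (ts : Fin (S.arity R) → Tm S) (i : Fin (S.arity R)) :
      HasTerm (.rel R ts) (ts i)
  | eqLeft (s t : Tm S) : HasTerm (.eq s t) s
  | eqRight (s t : Tm S) : HasTerm (.eq s t) t

/-! ### Deductions

Deductions are trees.  The leaf `hyp i` is an assumption of the assumption class `i`; a rule that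
discharges assumptions above one of its premises binds class `0` there (`(∃E)` binds classes `0`
and `1`), and the classes open below the rule are raised accordingly.  Vacuous discharge is allowed.
Likewise the parameter that belongs to an application of `(∀I)` or `(∃E)` is parameter `0`
above that application, and the parameters of the rest of the deduction are raised by one
there: every such application has its own parameter, which occurs nowhere else. -/

/-- Deduction trees. The data recorded with the rules are those that determine the formulas. -/
inductive Pf (S : Sig.{u, v}) where
  /-- an assumption of class `i` -/
  | hyp (i : ℕ)
  | andI (p q : Pf S)
  | andE₁ (p : Pf S)
  | andE₂ (p : Pf S)
  /-- concludes `A → B`, discharging class `0` (formula `A`) in `p` -/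
  | impI (A : Fml S) (p : Pf S)
  | impE (p q : Pf S)
  /-- concludes `A ∨ B` from a deduction `p` of `A` -/
  | orI₁ (B : Fml S) (p : Pf S)
  /-- concludes `A ∨ B` from a deduction `p` of `B` -/
  | orI₂ (A : Fml S) (p : Pf S)
  /-- discharges class `0` in `q` and in `r` -/
  | orE (p q r : Pf S)
  /-- concludes `A` from `⊥` -/
  | botE (A : Fml S) (p : Pf S)
  /-- discharges class `0` (formula `∃! a`) in `p`, whose own parameter `a` is parameter `0` -/
  | allI (p : Pf S)
  | allE (t : Tm S) (p q : Pf S)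
  /-- concludes `∃ x A` from `A` with `t` for `x` and `∃! t` -/
  | exI (A : Fml S) (t : Tm S) (p q : Pf S)
  /-- discharges class `0` (formula `∃! a`) and class `1` (formula `A` with `a` for `x`) in `q`,
  whose own parameter `a` is parameter `0` -/
  | exE (p q : Pf S)
  /-- concludes `t = t` from `∃! t` -/
  | eqI (p : Pf S)
  /-- concludes `A.inst t` from `s = t` and `A.inst s` -/
  | eqE (A : Fml S) (s t : Tm S) (p q : Pf S)
  /-- `(AD)`: concludes `∃! t` from the formula `A` -/
  | ad (A : Fml S) (t : Tm S) (p : Pf S)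

/-- `Proves Γ p A`: `p` is a deduction in `INF` of `A` from some of the formulas of `Γ` as open
assumptions, where the `i`-th formula of `Γ` belongs to assumption class `i`. -/
inductive Proves : List (Fml S) → Pf S → Fml S → Prop
  | hyp {Γ A} (i : ℕ) : Γ[i]? = some A → Proves Γ (.hyp i) A
  | andI {Γ A B p q} : Proves Γ p A → Proves Γ q B → Proves Γ (.andI p q) (.and A B)
  | andE₁ {Γ A B p} : Proves Γ p (.and A B) → Proves Γ (.andE₁ p) A
  | andE₂ {Γ A B p} : Proves Γ p (.and A B) → Proves Γ (.andE₂ p) B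
  | impI {Γ A B p} : Proves (A :: Γ) p B → Proves Γ (.impI A p) (.imp A B)
  | impE {Γ A B p q} : Proves Γ p (.imp A B) → Proves Γ q A → Proves Γ (.impE p q) B
  | orI₁ {Γ A B p} : Proves Γ p A → Proves Γ (.orI₁ B p) (.or A B)
  | orI₂ {Γ A B p} : Proves Γ p B → Proves Γ (.orI₂ A p) (.or A B)
  | orE {Γ A B D p q r} : Proves Γ p (.or A B) → Proves (A :: Γ) q D → Proves (B :: Γ) r D →
      Proves Γ (.orE p q r) D
  | botE {Γ A p} : Proves Γ p .bot → Proves Γ (.botE A p) A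
  | allI {Γ A p} : Proves (.exi (.var 0) :: Γ.map Fml.shift) p A → Proves Γ (.allI p) (.all A)
  | allE {Γ A t p q} : Proves Γ p (.all A) → Proves Γ q (.exi t) →
      Proves Γ (.allE t p q) (A.inst t)
  | exI {Γ A t p q} : Proves Γ p (A.inst t) → Proves Γ q (.exi t) →
      Proves Γ (.exI A t p q) (.ex A)
  | exE {Γ A D p q} : Proves Γ p (.ex A) →
      Proves (.exi (.var 0) :: A :: Γ.map Fml.shift) q D.shift → Proves Γ (.exE p q) D
  | eqI {Γ t p} : Proves Γ p (.exi t) → Proves Γ (.eqI p) (.eq t t)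
  | eqE {Γ A s t p q} : Proves Γ p (.eq s t) → Proves Γ q (A.inst s) →
      Proves Γ (.eqE A s t p q) (A.inst t)
  | ad {Γ A t p} : Proves Γ p A → A.HasTerm t → Proves Γ (.ad A t p) (.exi t)

/-! ### Substitution in deductions -/

/-- A renaming of assumption classes, moved below the discharge of one class. -/
def upR (ρ : ℕ → ℕ) : ℕ → ℕ
  | 0 => 0
  | n + 1 => ρ n + 1

/-- Renaming of the open assumption classes. -/
def Pf.ren : (ℕ → ℕ) → Pf S → Pf S
  | ρ, .hyp i => .hyp (ρ i)
  | ρ, .andI p q => .andI (p.ren ρ) (q.ren ρ)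
  | ρ, .andE₁ p => .andE₁ (p.ren ρ)
  | ρ, .andE₂ p => .andE₂ (p.ren ρ)
  | ρ, .impI A p => .impI A (p.ren (upR ρ))
  | ρ, .impE p q => .impE (p.ren ρ) (q.ren ρ)
  | ρ, .orI₁ B p => .orI₁ B (p.ren ρ)
  | ρ, .orI₂ A p => .orI₂ A (p.ren ρ)
  | ρ, .orE p q r => .orE (p.ren ρ) (q.ren (upR ρ)) (r.ren (upR ρ))
  | ρ, .botE A p => .botE A (p.ren ρ)
  | ρ, .allI p => .allI (p.ren (upR ρ))
  | ρ, .allE t p q => .allE t (p.ren ρ) (q.ren ρ)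
  | ρ, .exI A t p q => .exI A t (p.ren ρ) (q.ren ρ)
  | ρ, .exE p q => .exE (p.ren ρ) (q.ren (upR (upR ρ)))
  | ρ, .eqI p => .eqI (p.ren ρ)
  | ρ, .eqE A s t p q => .eqE A s t (p.ren ρ) (q.ren ρ)
  | ρ, .ad A t p => .ad A t (p.ren ρ)

/-- Substitution of terms for parameters throughout a deduction. -/
def Pf.substT : (ℕ → Tm S) → Pf S → Pf S
  | _, .hyp i => .hyp i
  | σ, .andI p q => .andI (p.substT σ) (q.substT σ)
  | σ, .andE₁ p => .andE₁ (p.substT σ)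
  | σ, .andE₂ p => .andE₂ (p.substT σ)
  | σ, .impI A p => .impI (A.subst σ) (p.substT σ)
  | σ, .impE p q => .impE (p.substT σ) (q.substT σ)
  | σ, .orI₁ B p => .orI₁ (B.subst σ) (p.substT σ)
  | σ, .orI₂ A p => .orI₂ (A.subst σ) (p.substT σ)
  | σ, .orE p q r => .orE (p.substT σ) (q.substT σ) (r.substT σ)
  | σ, .botE A p => .botE (A.subst σ) (p.substT σ)
  | σ, .allI p => .allI (p.substT (upσ σ))
  | σ, .allE t p q => .allE (t.subst σ) (p.substT σ) (q.substT σ)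
  | σ, .exI A t p q => .exI (A.subst (upσ σ)) (t.subst σ) (p.substT σ) (q.substT σ)
  | σ, .exE p q => .exE (p.substT σ) (q.substT (upσ σ))
  | σ, .eqI p => .eqI (p.substT σ)
  | σ, .eqE A s t p q =>
      .eqE (A.subst (upσ σ)) (s.subst σ) (t.subst σ) (p.substT σ) (q.substT σ)
  | σ, .ad A t p => .ad (A.subst σ) (t.subst σ) (p.substT σ)

/-- The deduction `p`, moved into the scope of a discharge of one assumption class. -/
def Pf.wk (p : Pf S) : Pf S := p.ren (fun n => n + 1)

/-- The deduction `p`, moved into the scope of a new parameter. -/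
def Pf.shift (p : Pf S) : Pf S := p.substT shiftσ

/-- An assignment of deductions to classes, moved below the discharge of one class. -/
def upH (τ : ℕ → Pf S) : ℕ → Pf S
  | 0 => .hyp 0
  | n + 1 => (τ n).wk

/-- Simultaneous replacement of the open assumptions of each class `i` by the deduction `τ i`. -/
def Pf.substH : (ℕ → Pf S) → Pf S → Pf S
  | τ, .hyp i => τ i
  | τ, .andI p q => .andI (p.substH τ) (q.substH τ)
  | τ, .andE₁ p => .andE₁ (p.substH τ)
  | τ, .andE₂ p => .andE₂ (p.substH τ)
  | τ, .impI A p => .impI A (p.substH (upH τ))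
  | τ, .impE p q => .impE (p.substH τ) (q.substH τ)
  | τ, .orI₁ B p => .orI₁ B (p.substH τ)
  | τ, .orI₂ A p => .orI₂ A (p.substH τ)
  | τ, .orE p q r => .orE (p.substH τ) (q.substH (upH τ)) (r.substH (upH τ))
  | τ, .botE A p => .botE A (p.substH τ)
  | τ, .allI p => .allI (p.substH (upH (fun n => (τ n).shift)))
  | τ, .allE t p q => .allE t (p.substH τ) (q.substH τ)
  | τ, .exI A t p q => .exI A t (p.substH τ) (q.substH τ)
  | τ, .exE p q => .exE (p.substH τ) (q.substH (upH (upH (fun n => (τ n).shift))))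
  | τ, .eqI p => .eqI (p.substH τ)
  | τ, .eqE A s t p q => .eqE A s t (p.substH τ) (q.substH τ)
  | τ, .ad A t p => .ad A t (p.substH τ)

/-- `p.inst₁ q`: the deduction `q` concludes all assumptions of class `0` in `p`. -/
def Pf.inst₁ (p q : Pf S) : Pf S :=
  p.substH fun
    | 0 => q
    | n + 1 => .hyp n

/-- `p.inst₂ q r`: `q` concludes all assumptions of class `0` and `r` all of class `1` in `p`. -/
def Pf.inst₂ (p q r : Pf S) : Pf S :=
  p.substH fun
    | 0 => q
    | 1 => r
    | n + 2 => .hyp n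

/-! ### Formula occurrences, segments and normal form

The formula occurrences of a deduction are its nodes.  A node is given by its address, the list
of the numbers (from `0`, from the left) of the premises that lead to it from the conclusion. -/

/-- The subdeductions of the premises of the last rule, from left to right. -/
def Pf.premises : Pf S → List (Pf S)
  | .hyp _ => []
  | .andI p q => [p, q]
  | .andE₁ p => [p]
  | .andE₂ p => [p]
  | .impI _ p => [p]
  | .impE p q => [p, q]
  | .orI₁ _ p => [p]
  | .orI₂ _ p => [p]
  | .orE p q r => [p, q, r]
  | .botE _ p => [p]
  | .allI p => [p]
  | .allE _ p q => [p, q]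
  | .exI _ _ p q => [p, q]
  | .exE p q => [p, q]
  | .eqI p => [p]
  | .eqE _ _ _ p q => [p, q]
  | .ad _ _ p => [p]

/-- `D.Sub a p`: `a` is the address of a formula occurrence in `D`, and `p` is the subdeduction
of `D` that ends in it. -/
inductive Pf.Sub : Pf S → List ℕ → Pf S → Prop
  | nil (p : Pf S) : Sub p [] p
  | cons {p p' q : Pf S} {i : ℕ} {a : List ℕ} :
      p.premises[i]? = some p' → Sub p' a q → Sub p (i :: a) q

/-- The last rule is an introduction rule. -/
inductive Pf.EndsIntro : Pf S → Prop
  | andI (p q) : EndsIntro (.andI p q)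
  | impI (A p) : EndsIntro (.impI A p)
  | orI₁ (B p) : EndsIntro (.orI₁ B p)
  | orI₂ (A p) : EndsIntro (.orI₂ A p)
  | allI (p) : EndsIntro (.allI p)
  | exI (A t p q) : EndsIntro (.exI A t p q)
  | eqI (p) : EndsIntro (.eqI p)

/-- The last rule is an elimination rule. Its major premise is the leftmost premise. -/
inductive Pf.EndsElim : Pf S → Prop
  | andE₁ (p) : EndsElim (.andE₁ p)
  | andE₂ (p) : EndsElim (.andE₂ p)
  | impE (p q) : EndsElim (.impE p q)
  | orE (p q r) : EndsElim (.orE p q r)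
  | botE (A p) : EndsElim (.botE A p)
  | allE (t p q) : EndsElim (.allE t p q)
  | exE (p q) : EndsElim (.exE p q)
  | eqE (A s t p q) : EndsElim (.eqE A s t p q)

/-- The last rule is `(∨E)` or `(∃E)`. All their premises but the leftmost are minor premises. -/
inductive Pf.EndsOrEx : Pf S → Prop
  | orE (p q r) : EndsOrEx (.orE p q r)
  | exE (p q) : EndsOrEx (.exE p q)

/-- The last rule is `(=E)`. Premise `1` is its minor premise. -/
inductive Pf.EndsEqE : Pf S → Prop
  | eqE (A s t p q) : EndsEqE (.eqE A s t p q)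

/-- The last rule is `(=I)`. -/
inductive Pf.EndsEqI : Pf S → Prop
  | eqI (p) : EndsEqI (.eqI p)

/-- The last rule is `(AD)`. -/
inductive Pf.EndsAD : Pf S → Prop
  | ad (A t p) : EndsAD (.ad A t p)

/-- The last rule is `(AD)`, applied to a premise `t = t`. -/
inductive Pf.EndsADSelf : Pf S → Prop
  | ad (t p) : EndsADSelf (.ad (.eq t t) t p)

/-- The occurrence `a` of `D` is concluded by a rule as described by `K`. -/
def ConclOf (D : Pf S) (K : Pf S → Prop) (a : List ℕ) : Prop :=
  ∃ p, D.Sub a p ∧ K p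

/-- The occurrence `a` of `D` is premise number `i` of the application of a rule as described
by `K`, and `b` is the conclusion of that application. -/
def PremOf (D : Pf S) (K : Pf S → Prop) (i : ℕ) (a b : List ℕ) : Prop :=
  a = b ++ [i] ∧ (∃ q, D.Sub a q) ∧ ConclOf D K b

/-- `a` is a minor premise of an application of `(∨E)` or `(∃E)` with conclusion `b`. -/
def MinorOrEx (D : Pf S) (a b : List ℕ) : Prop :=
  ∃ i, 0 < i ∧ PremOf D Pf.EndsOrEx i a b

/-- A segment of `D`, as the list of its formula occurrences, from top to bottom; `a` is its first
and `b` its last occurrence. -/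
structure IsSegment (D : Pf S) (l : List (List ℕ)) (a b : List ℕ) : Prop where
  head : l.head? = some a
  last : l.getLast? = some b
  occ : ∀ c ∈ l, ∃ p, D.Sub c p
  head_not_concl : ¬ ConclOf D Pf.EndsOrEx a
  last_not_minor : ¬ ∃ c, MinorOrEx D b c
  chain : l.IsChain (MinorOrEx D)

/-- A maximal `I/E`-segment: its last formula is the major premise of an elimination rule, and if
its length is `1`, it is the conclusion of an introduction rule. -/
def IsMaxIE (D : Pf S) (l : List (List ℕ)) : Prop :=
  ∃ a b, IsSegment D l a b ∧ (∃ c, PremOf D Pf.EndsElim 0 b c) ∧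
    (l.length = 1 → ConclOf D Pf.EndsIntro a)

/-- A maximal `=`-segment: its first formula is concluded by `(=I)`, its last is the premise
of `(AD)`. -/
def IsMaxEq (D : Pf S) (l : List (List ℕ)) : Prop :=
  ∃ a b, IsSegment D l a b ∧ ConclOf D Pf.EndsEqI a ∧ ∃ c, PremOf D Pf.EndsAD 0 b c

/-- A maximal `∃!`-segment: its first formula is concluded from `t = t` by `(AD)`, its last is the
premise of `(=I)`. -/
def IsMaxExi (D : Pf S) (l : List (List ℕ)) : Prop :=
  ∃ a b, IsSegment D l a b ∧ ConclOf D Pf.EndsADSelf a ∧ ∃ c, PremOf D Pf.EndsEqI 0 b c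

/-- `(=E)` leads from the last occurrence of the segment `l` (as minor premise) to the first
occurrence of the segment `l'`. -/
def EqELink (D : Pf S) (l l' : List (List ℕ)) : Prop :=
  ∃ b a', l.getLast? = some b ∧ l'.head? = some a' ∧ PremOf D Pf.EndsEqE 1 b a'

/-- An `(=E)`-segment of `D`: a sequence of segments (from top to bottom), the first of which is
minor premise but not conclusion of `(=E)`, the last of which is conclusion but not minor premise
of `(=E)`, while all others are both. -/
structure IsEqESegment (D : Pf S) (L : List (List (List ℕ))) : Prop where
  length : 2 ≤ L.length
  seg : ∀ l ∈ L, ∃ a b, IsSegment D l a b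
  chain : L.IsChain (EqELink D)
  head_not_concl : ∀ l a, L.head? = some l → l.head? = some a → ¬ ConclOf D Pf.EndsEqE a
  last_not_minor : ∀ l b, L.getLast? = some l → l.getLast? = some b →
    ¬ ∃ c, PremOf D Pf.EndsEqE 1 b c

/-- An `(=E)`-segment is maximal if its last segment is premise of `(AD)` or if all formulas on it
are formed from `∃!` and a term.  Every formula on it is the minor premise or the conclusion of an
application of `(=E)` that concludes the first formula of one of its segments. -/
def IsMaxEqE (D : Pf S) (L : List (List (List ℕ))) : Prop :=
  IsEqESegment D L ∧
    ((∃ l b c, L.getLast? = some l ∧ l.getLast? = some b ∧ PremOf D Pf.EndsAD 0 b c) ∨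
      ∀ l ∈ L, ∀ a, l.head? = some a → ∀ A s t p q, D.Sub a (.eqE A s t p q) →
        (∃ u, A.inst s = .exi u) ∧ ∃ w, A.inst t = .exi w)

/-- A deduction is in normal form if it contains no maximal segments. -/
structure Normal (D : Pf S) : Prop where
  noMaxIE : ¬ ∃ l, IsMaxIE D l
  noMaxEq : ¬ ∃ l, IsMaxEq D l
  noMaxExi : ¬ ∃ l, IsMaxExi D l
  noMaxEqE : ¬ ∃ L, IsMaxEqE D L

/-- The applications of `(=E)` and of `(⊥E)` are restricted to prime conclusions. -/
structure Restricted (D : Pf S) : Prop where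
  eqE : ∀ a A s t p q, D.Sub a (.eqE A s t p q) → A.IsPrime
  botE : ∀ a A p, D.Sub a (.botE A p) → A.IsPrime

/-- There are no vacuous applications of `(=E)`: none with a major premise `t = t`, and none with
identical minor premise and conclusion. -/
def NoVacuousEqE (D : Pf S) : Prop :=
  ∀ a A s t p q, D.Sub a (.eqE A s t p q) → s ≠ t ∧ A.inst s ≠ A.inst t

/-! ### Transformations of deductions -/

/-- The compatible closure of a relation: the transformation of one subdeduction. -/
inductive Compat (R : Pf S → Pf S → Prop) : Pf S → Pf S → Prop
  | base {p p'} : R p p' → Compat R p p'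
  | andIl {p p'} (q) : Compat R p p' → Compat R (.andI p q) (.andI p' q)
  | andIr (p) {q q'} : Compat R q q' → Compat R (.andI p q) (.andI p q')
  | andE₁ {p p'} : Compat R p p' → Compat R (.andE₁ p) (.andE₁ p')
  | andE₂ {p p'} : Compat R p p' → Compat R (.andE₂ p) (.andE₂ p')
  | impI (A) {p p'} : Compat R p p' → Compat R (.impI A p) (.impI A p')
  | impEl {p p'} (q) : Compat R p p' → Compat R (.impE p q) (.impE p' q)
  | impEr (p) {q q'} : Compat R q q' → Compat R (.impE p q) (.impE p q')
  | orI₁ (B) {p p'} : Compat R p p' → Compat R (.orI₁ B p) (.orI₁ B p')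
  | orI₂ (A) {p p'} : Compat R p p' → Compat R (.orI₂ A p) (.orI₂ A p')
  | orEl {p p'} (q r) : Compat R p p' → Compat R (.orE p q r) (.orE p' q r)
  | orEm (p) {q q'} (r) : Compat R q q' → Compat R (.orE p q r) (.orE p q' r)
  | orEr (p q) {r r'} : Compat R r r' → Compat R (.orE p q r) (.orE p q r')
  | botE (A) {p p'} : Compat R p p' → Compat R (.botE A p) (.botE A p')
  | allI {p p'} : Compat R p p' → Compat R (.allI p) (.allI p')
  | allEl (t) {p p'} (q) : Compat R p p' → Compat R (.allE t p q) (.allE t p' q)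
  | allEr (t p) {q q'} : Compat R q q' → Compat R (.allE t p q) (.allE t p q')
  | exIl (A t) {p p'} (q) : Compat R p p' → Compat R (.exI A t p q) (.exI A t p' q)
  | exIr (A t p) {q q'} : Compat R q q' → Compat R (.exI A t p q) (.exI A t p q')
  | exEl {p p'} (q) : Compat R p p' → Compat R (.exE p q) (.exE p' q)
  | exEr (p) {q q'} : Compat R q q' → Compat R (.exE p q) (.exE p q')
  | eqI {p p'} : Compat R p p' → Compat R (.eqI p) (.eqI p')
  | eqEl (A s t) {p p'} (q) : Compat R p p' → Compat R (.eqE A s t p q) (.eqE A s t p' q)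
  | eqEr (A s t p) {q q'} : Compat R q q' → Compat R (.eqE A s t p q) (.eqE A s t p q')
  | ad (A t) {p p'} : Compat R p p' → Compat R (.ad A t p) (.ad A t p')

/-- The deduction of `t = s` from a deduction of `s = t`. -/
def Pf.symm (s t : Tm S) (p : Pf S) : Pf S :=
  .eqE (.eq (.var 0) s.shift) s t p (.eqI (.ad (.eq s t) s p))

/-- The transformations by which `(=E)` and `(⊥E)` are restricted to prime conclusions: a
compound formula is broken up by elimination rules, the rule is applied to the immediate
subformulas, and the formula is put together again by introduction rules. -/
inductive RestrictRule : Pf S → Pf S → Prop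
  | eqBot (s t p q) : RestrictRule (.eqE .bot s t p q) q
  | eqAnd (A B s t p q) : RestrictRule (.eqE (.and A B) s t p q)
      (.andI (.eqE A s t p (.andE₁ q)) (.eqE B s t p (.andE₂ q)))
  | eqOr (A B s t p q) : RestrictRule (.eqE (.or A B) s t p q)
      (.orE q (.orI₁ (B.inst t) (.eqE A s t p.wk (.hyp 0)))
        (.orI₂ (A.inst t) (.eqE B s t p.wk (.hyp 0))))
  | eqImp (A B s t p q) : RestrictRule (.eqE (.imp A B) s t p q)
      (.impI (A.inst t)
        (.eqE B s t p.wk (.impE q.wk (.eqE A t s (Pf.symm s t p.wk) (.hyp 0)))))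
  | eqAll (A s t p q) : RestrictRule (.eqE (.all A) s t p q)
      (.allI (.eqE (A.subst swapσ) s.shift t.shift p.shift.wk
        (.allE (.var 0) q.shift.wk (.hyp 0))))
  | eqEx (A s t p q) : RestrictRule (.eqE (.ex A) s t p q)
      (.exE q (.exI ((A.subst (upσ (instσ t))).subst (upσ shiftσ)) (.var 0)
        (.eqE (A.subst swapσ) s.shift t.shift p.shift.wk.wk (.hyp 1)) (.hyp 0)))
  | botBot (p) : RestrictRule (.botE .bot p) p
  | botAnd (A B p) : RestrictRule (.botE (.and A B) p) (.andI (.botE A p) (.botE B p))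
  | botOr₁ (A B p) : RestrictRule (.botE (.or A B) p) (.orI₁ B (.botE A p))
  | botOr₂ (A B p) : RestrictRule (.botE (.or A B) p) (.orI₂ A (.botE B p))
  | botImp (A B p) : RestrictRule (.botE (.imp A B) p) (.impI A (.botE B p.wk))
  | botAll (A p) : RestrictRule (.botE (.all A) p) (.allI (.botE A p.shift.wk))
  | botEx (A t p) : RestrictRule (.botE (.ex A) p)
      (.exI A t (.botE (A.inst t) p) (.botE (.exi t) p))

/-- A rule application with one premise left open: the major premise of an elimination rule, or
the premise of `(=I)` or `(AD)`. -/
inductive Frame (S : Sig.{u, v}) where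
  | andE₁
  | andE₂
  | impE (q : Pf S)
  | orE (q r : Pf S)
  | botE (A : Fml S)
  | allE (t : Tm S) (q : Pf S)
  | exE (q : Pf S)
  | eqE (A : Fml S) (s t : Tm S) (q : Pf S)
  | eqI
  | ad (A : Fml S) (t : Tm S)

/-- Apply the rule of the frame to the conclusion of `p`. -/
def Frame.plug : Frame S → Pf S → Pf S
  | .andE₁, p => .andE₁ p
  | .andE₂, p => .andE₂ p
  | .impE q, p => .impE p q
  | .orE q r, p => .orE p q r
  | .botE A, p => .botE A p
  | .allE t q, p => .allE t p q
  | .exE q, p => .exE p q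
  | .eqE A s t q, p => .eqE A s t p q
  | .eqI, p => .eqI p
  | .ad A t, p => .ad A t p

/-- The frame, moved into the scope of a discharge of one assumption class. -/
def Frame.wk : Frame S → Frame S
  | .andE₁ => .andE₁
  | .andE₂ => .andE₂
  | .impE q => .impE q.wk
  | .orE q r => .orE (q.ren (upR (fun n => n + 1))) (r.ren (upR (fun n => n + 1)))
  | .botE A => .botE A
  | .allE t q => .allE t q.wk
  | .exE q => .exE (q.ren (upR (upR (fun n => n + 1))))
  | .eqE A s t q => .eqE A s t q.wk
  | .eqI => .eqI
  | .ad A t => .ad A t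

/-- The frame, moved into the scope of a new parameter. -/
def Frame.shift : Frame S → Frame S
  | .andE₁ => .andE₁
  | .andE₂ => .andE₂
  | .impE q => .impE q.shift
  | .orE q r => .orE q.shift r.shift
  | .botE A => .botE A.shift
  | .allE t q => .allE t.shift q.shift
  | .exE q => .exE (q.substT (upσ shiftσ))
  | .eqE A s t q => .eqE (A.subst (upσ shiftσ)) s.shift t.shift q.shift
  | .eqI => .eqI
  | .ad A t => .ad A.shift t.shift

/-- The reduction procedures. -/
inductive RedRule : Pf S → Pf S → Prop
  /- Maximal formulas: conclusions of introduction rules that are major premises of elimination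
  rules. (For `=` see `vacEqE`.) -/
  | and₁ (p q) : RedRule (.andE₁ (.andI p q)) p
  | and₂ (p q) : RedRule (.andE₂ (.andI p q)) q
  | imp (A p q) : RedRule (.impE (.impI A p) q) (p.inst₁ q)
  | or₁ (B p q r) : RedRule (.orE (.orI₁ B p) q r) (q.inst₁ p)
  | or₂ (A p q r) : RedRule (.orE (.orI₂ A p) q r) (r.inst₁ p)
  | all (t p q) : RedRule (.allE t (.allI p) q) ((p.substT (instσ t)).inst₁ q)
  | ex (A t p q r) : RedRule (.exE (.exI A t p q) r) ((r.substT (instσ t)).inst₂ q p)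
  /- Permutative reductions: a rule applied to the conclusion of `(∨E)` or `(∃E)` is applied
  to the minor premises instead. -/
  | permOr (F : Frame S) (p q r) :
      RedRule (F.plug (.orE p q r)) (.orE p (F.wk.plug q) (F.wk.plug r))
  | permEx (F : Frame S) (p q) :
      RedRule (F.plug (.exE p q)) (.exE p (F.shift.wk.wk.plug q))
  /- Removal of `(∨E)` and `(∃E)` with vacuous discharge. The parameter of a removed
  application of `(∃E)` may be chosen anew. -/
  | vacOr₁ (p q r : Pf S) : RedRule (.orE p q.wk r) q
  | vacOr₂ (p q r : Pf S) : RedRule (.orE p q r.wk) r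
  | vacEx (p q : Pf S) (n : ℕ) : RedRule (.exE p q.wk.wk) (q.substT (instσ (.var n)))
  /- Removal of applications of `(=E)` with identical minor premise and conclusion; this is so
  if the major premise is `t = t`. -/
  | vacEqE (A s t p q) : A.inst s = A.inst t → RedRule (.eqE A s t p q) q
  /- Procedure for maximal `=`- and `∃!`-segments. -/
  | maxEq (t p) : RedRule (.ad (.eq t t) t (.eqI p)) p
  | maxExi (t p) : RedRule (.eqI (.ad (.eq t t) t p)) p
  /- Procedure for maximal `(=E)`-segments: a conclusion `∃! t` of `(=E)` is inferred from the
  major premise `s = t`. -/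
  | eqEExi (s t p q) : RedRule (.eqE (.exi (.var 0)) s t p q) (.ad (.eq s t) t p)
  /- Procedure for maximal `(=E)`-segments: the conclusion `∃! w` of `(AD)` is inferred from the
  major premise of the preceding application of `(=E)` if `w` occurs in it, and otherwise from
  the minor premise. -/
  | adMajor (A B s t w p q) : w = s ∨ w = t →
      RedRule (.ad B w (.eqE A s t p q)) (.ad (.eq s t) w p)
  | adMinor (A B s t w p q) : w ≠ s → w ≠ t →
      RedRule (.ad B w (.eqE A s t p q)) (.ad (A.inst s) w q)

/-- `D` is transformed into `D'` by finitely many of the steps that restrict `(=E)` and `(⊥E)`. -/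
def RestrictsTo (D D' : Pf S) : Prop := Relation.ReflTransGen (Compat RestrictRule) D D'

/-- `D` is transformed into `D'` by finitely many applications of the reduction procedures. -/
def ReducesTo (D D' : Pf S) : Prop := Relation.ReflTransGen (Compat RedRule) D D'

end INF

/-!
Restriction is an induction on the size of the conclusion of `(=E)` or `(⊥E)`
(`exists_restricted_botE`, `exists_restricted_eqE`).

Normalization is by hereditary substitution.  Call a restricted deduction normal (`NF`) if it has no
redexes other than `(∨E)` and `(∃E)` with vacuous discharge; such deductions have no maximal segments
(`NF.normal`): a segment that ends in a major premise or in the premise of `(=I)` or `(AD)` has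
length `1` there, so that a maximal one would form a redex, and each `(=E)` with conclusion `∃! t` is
a redex.  In a normal deduction, the major premise of an elimination is neutral: it is an assumption
or concluded by `(∧E)`, `(→E)` or `(∀E)`.  The only exception is the equation that is major premise
of `(=E)`.

Two statements are proved together, by induction on the size `n` of a formula.

* A rule applied to a normal deduction of a formula of size at most `n` normalizes
  (`NF.normalizes_plug`), by induction on that deduction.  If it ends with `(∨E)` or `(∃E)`, the rule
  is permuted to the minor premises, to which the induction hypothesis applies.  If it ends with an
  introduction, the resulting detour is removed by substituting normal deductions of formulas of size
  less than `n` in a normal deduction.  The redexes formed with `(=I)`, `(AD)` and `(=E)` need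
  no substitution: their reduction moves the rule to a subdeduction or deletes it.
* Substitution of terms, and of normal deductions of formulas of size at most `n`, in a normal
  deduction normalizes (`substNormalizes`), by induction on the latter.  A major premise of an
  elimination either remains neutral, or its size is at most `n` and the first statement applies.
  Substitution of terms can make `(=E)` vacuous or identify terms in applications of `(AD)`, so that
  `(=E)`, `(=I)` and `(AD)` are always treated by the first statement, for prime formulas.

Every restricted deduction then normalizes by induction on its construction, and the normal form
keeps the formula, the assumptions and the restriction because these are built into `NF`.
-/

namespace INF

variable {S : Sig.{u, v}}

/-! ### Substitution of terms in formulas -/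

theorem Tm.subst_subst (σ σ' : ℕ → Tm S) (t : Tm S) :
    (t.subst σ).subst σ' = t.subst (fun n => (σ n).subst σ') := by
  cases t <;> rfl

theorem Tm.subst_var (t : Tm S) : t.subst Tm.var = t := by
  cases t <;> rfl

theorem upσ_var : upσ (Tm.var : ℕ → Tm S) = Tm.var := by
  funext n; cases n <;> rfl

theorem upσ_comp (σ σ' : ℕ → Tm S) :
    (fun n => (upσ σ n).subst (upσ σ')) = upσ (fun n => (σ n).subst σ') := by
  funext n
  cases n with
  | zero => rfl
  | succ n =>
    simp only [upσ]
    cases σ n <;> rfl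

theorem Fml.subst_subst (A : Fml S) : ∀ σ σ' : ℕ → Tm S,
    (A.subst σ).subst σ' = A.subst (fun n => (σ n).subst σ') := by
  induction A with
  | rel R ts => intro σ σ'; simp only [Fml.subst, Tm.subst_subst]
  | eq s t => intro σ σ'; simp only [Fml.subst, Tm.subst_subst]
  | exi t => intro σ σ'; simp only [Fml.subst, Tm.subst_subst]
  | bot => intro σ σ'; rfl
  | and A B ihA ihB => intro σ σ'; simp only [Fml.subst, ihA, ihB]
  | or A B ihA ihB => intro σ σ'; simp only [Fml.subst, ihA, ihB]
  | imp A B ihA ihB => intro σ σ'; simp only [Fml.subst, ihA, ihB]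
  | all A ih => intro σ σ'; simp only [Fml.subst, ih, upσ_comp]
  | ex A ih => intro σ σ'; simp only [Fml.subst, ih, upσ_comp]

theorem Fml.subst_var (A : Fml S) : A.subst Tm.var = A := by
  induction A <;> simp_all [Fml.subst, Tm.subst_var, upσ_var]

theorem Pf.substT_var (p : Pf S) : p.substT Tm.var = p := by
  induction p <;> simp_all [Pf.substT, Fml.subst_var, Tm.subst_var, upσ_var]

theorem Tm.shift_inst (s t : Tm S) : s.shift.subst (instσ t) = s := by
  cases s <;> rfl

theorem Fml.shift_inst (A : Fml S) (t : Tm S) : A.shift.inst t = A := by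
  rw [Fml.shift, Fml.inst, Fml.subst_subst]
  exact A.subst_var

theorem Fml.shift_subst (A : Fml S) (σ : ℕ → Tm S) :
    A.shift.subst (upσ σ) = (A.subst σ).shift := by
  rw [Fml.shift, Fml.shift, Fml.subst_subst, Fml.subst_subst]
  rfl

theorem Fml.inst_subst (A : Fml S) (t : Tm S) (σ : ℕ → Tm S) :
    (A.inst t).subst σ = (A.subst (upσ σ)).inst (t.subst σ) := by
  rw [Fml.inst, Fml.inst, Fml.subst_subst, Fml.subst_subst]
  congr 1
  funext n
  cases n with
  | zero => rfl
  | succ n => exact (Tm.shift_inst (σ n) _).symm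

/-- Generalizing a formula over its parameter `0` and instantiating it there again changes
nothing. -/
theorem Fml.upShift_inst (A : Fml S) : (A.subst (upσ shiftσ)).inst (.var 0) = A := by
  rw [Fml.inst, Fml.subst_subst]
  refine Eq.trans (congrArg (fun σ => A.subst σ) ?_) A.subst_var
  funext n
  cases n <;> rfl

theorem Fml.swap_inst (A : Fml S) (t : Tm S) :
    (A.subst swapσ).inst t.shift = A.subst (upσ (instσ t)) := by
  rw [Fml.inst, Fml.subst_subst]
  congr 1
  funext n
  match n with
  | 0 => rfl
  | 1 => rfl
  | n + 2 => rfl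

theorem map_shift_map_subst (Γ : List (Fml S)) (σ : ℕ → Tm S) :
    (Γ.map Fml.shift).map (Fml.subst (upσ σ)) = (Γ.map (Fml.subst σ)).map Fml.shift := by
  simp only [List.map_map]
  exact List.map_congr_left fun A _ => A.shift_subst σ

/-- The number of propositional connectives and quantifiers of a formula. -/
def Fml.size : Fml S → ℕ
  | .rel _ _ => 0
  | .eq _ _ => 0
  | .exi _ => 0
  | .bot => 0
  | .and A B => A.size + B.size + 1
  | .or A B => A.size + B.size + 1
  | .imp A B => A.size + B.size + 1
  | .all A => A.size + 1
  | .ex A => A.size + 1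

theorem Fml.size_subst (A : Fml S) : ∀ σ : ℕ → Tm S, (A.subst σ).size = A.size := by
  induction A <;> simp_all [Fml.subst, Fml.size]

theorem Fml.size_inst (A : Fml S) (t : Tm S) : (A.inst t).size = A.size := A.size_subst _

theorem Fml.IsPrime.subst {A : Fml S} (h : A.IsPrime) (σ : ℕ → Tm S) : (A.subst σ).IsPrime := by
  cases h <;> constructor

theorem Fml.HasTerm.subst {A : Fml S} {t : Tm S} (h : A.HasTerm t) (σ : ℕ → Tm S) :
    (A.subst σ).HasTerm (t.subst σ) := by
  cases h with
  | rel R ts i => exact .rel R (fun i => (ts i).subst σ) i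
  | eqLeft s t => exact .eqLeft _ _
  | eqRight s t => exact .eqRight _ _

/-- A substitution that can be undone by another one, such as an injective renaming. -/
def LeftInv (σ : ℕ → Tm S) : Prop := ∃ σ' : ℕ → Tm S, ∀ n, (σ n).subst σ' = .var n

theorem LeftInv.up {σ : ℕ → Tm S} (h : LeftInv σ) : LeftInv (upσ σ) := by
  obtain ⟨σ', h⟩ := h
  refine ⟨upσ σ', fun n => ?_⟩
  refine (congrFun (upσ_comp σ σ') n).trans ?_
  rw [funext h]
  exact congrFun upσ_var n

theorem leftInv_shiftσ : LeftInv (shiftσ : ℕ → Tm S) := ⟨instσ (.var 0), fun _ => rfl⟩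

theorem LeftInv.tm_injective {σ : ℕ → Tm S} (h : LeftInv σ) {s t : Tm S}
    (e : s.subst σ = t.subst σ) : s = t := by
  obtain ⟨σ', h⟩ := h
  have := congrArg (Tm.subst σ') e
  rwa [Tm.subst_subst, Tm.subst_subst, funext h, Tm.subst_var, Tm.subst_var] at this

theorem LeftInv.fml_injective {σ : ℕ → Tm S} (h : LeftInv σ) {A B : Fml S}
    (e : A.subst σ = B.subst σ) : A = B := by
  obtain ⟨σ', h⟩ := h
  have := congrArg (Fml.subst σ') e
  rwa [Fml.subst_subst, Fml.subst_subst, funext h, Fml.subst_var, Fml.subst_var] at this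

/-! ### Deductions with a local condition -/

/-- `ProvesWith K Γ p A`: `p` is a deduction of `A` from `Γ`, and `K` holds of all its
subdeductions. -/
inductive ProvesWith (K : Pf S → Prop) : List (Fml S) → Pf S → Fml S → Prop
  | hyp {Γ A} (i : ℕ) : K (.hyp i) → Γ[i]? = some A → ProvesWith K Γ (.hyp i) A
  | andI {Γ A B p q} : K (.andI p q) → ProvesWith K Γ p A → ProvesWith K Γ q B →
      ProvesWith K Γ (.andI p q) (.and A B)
  | andE₁ {Γ A B p} : K (.andE₁ p) → ProvesWith K Γ p (.and A B) → ProvesWith K Γ (.andE₁ p) A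
  | andE₂ {Γ A B p} : K (.andE₂ p) → ProvesWith K Γ p (.and A B) → ProvesWith K Γ (.andE₂ p) B
  | impI {Γ A B p} : K (.impI A p) → ProvesWith K (A :: Γ) p B →
      ProvesWith K Γ (.impI A p) (.imp A B)
  | impE {Γ A B p q} : K (.impE p q) → ProvesWith K Γ p (.imp A B) → ProvesWith K Γ q A →
      ProvesWith K Γ (.impE p q) B
  | orI₁ {Γ A B p} : K (.orI₁ B p) → ProvesWith K Γ p A → ProvesWith K Γ (.orI₁ B p) (.or A B)
  | orI₂ {Γ A B p} : K (.orI₂ A p) → ProvesWith K Γ p B → ProvesWith K Γ (.orI₂ A p) (.or A B)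
  | orE {Γ A B D p q r} : K (.orE p q r) → ProvesWith K Γ p (.or A B) →
      ProvesWith K (A :: Γ) q D → ProvesWith K (B :: Γ) r D → ProvesWith K Γ (.orE p q r) D
  | botE {Γ A p} : K (.botE A p) → ProvesWith K Γ p .bot → ProvesWith K Γ (.botE A p) A
  | allI {Γ A p} : K (.allI p) → ProvesWith K (.exi (.var 0) :: Γ.map Fml.shift) p A →
      ProvesWith K Γ (.allI p) (.all A)
  | allE {Γ A t p q} : K (.allE t p q) → ProvesWith K Γ p (.all A) → ProvesWith K Γ q (.exi t) →
      ProvesWith K Γ (.allE t p q) (A.inst t)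
  | exI {Γ A t p q} : K (.exI A t p q) → ProvesWith K Γ p (A.inst t) →
      ProvesWith K Γ q (.exi t) → ProvesWith K Γ (.exI A t p q) (.ex A)
  | exE {Γ A D p q} : K (.exE p q) → ProvesWith K Γ p (.ex A) →
      ProvesWith K (.exi (.var 0) :: A :: Γ.map Fml.shift) q D.shift →
      ProvesWith K Γ (.exE p q) D
  | eqI {Γ t p} : K (.eqI p) → ProvesWith K Γ p (.exi t) → ProvesWith K Γ (.eqI p) (.eq t t)
  | eqE {Γ A s t p q} : K (.eqE A s t p q) → ProvesWith K Γ p (.eq s t) →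
      ProvesWith K Γ q (A.inst s) → ProvesWith K Γ (.eqE A s t p q) (A.inst t)
  | ad {Γ A t p} : K (.ad A t p) → ProvesWith K Γ p A → A.HasTerm t →
      ProvesWith K Γ (.ad A t p) (.exi t)

theorem ProvesWith.proves {K : Pf S → Prop} {Γ p A} (h : ProvesWith K Γ p A) : Proves Γ p A := by
  induction h with
  | hyp i _ h => exact .hyp i h
  | andI _ _ _ h₁ h₂ => exact .andI h₁ h₂
  | andE₁ _ _ h => exact .andE₁ h
  | andE₂ _ _ h => exact .andE₂ h
  | impI _ _ h => exact .impI h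
  | impE _ _ _ h₁ h₂ => exact .impE h₁ h₂
  | orI₁ _ _ h => exact .orI₁ h
  | orI₂ _ _ h => exact .orI₂ h
  | orE _ _ _ _ h₁ h₂ h₃ => exact .orE h₁ h₂ h₃
  | botE _ _ h => exact .botE h
  | allI _ _ h => exact .allI h
  | allE _ _ _ h₁ h₂ => exact .allE h₁ h₂
  | exI _ _ _ h₁ h₂ => exact .exI h₁ h₂
  | exE _ _ _ h₁ h₂ => exact .exE h₁ h₂
  | eqI _ _ h => exact .eqI h
  | eqE _ _ _ h₁ h₂ => exact .eqE h₁ h₂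
  | ad _ _ ht h => exact .ad h ht

theorem ProvesWith.mono {K K' : Pf S → Prop} (hK : ∀ p, K p → K' p) {Γ p A}
    (h : ProvesWith K Γ p A) : ProvesWith K' Γ p A := by
  induction h with
  | hyp i k h => exact .hyp i (hK _ k) h
  | andI k _ _ h₁ h₂ => exact .andI (hK _ k) h₁ h₂
  | andE₁ k _ h => exact .andE₁ (hK _ k) h
  | andE₂ k _ h => exact .andE₂ (hK _ k) h
  | impI k _ h => exact .impI (hK _ k) h
  | impE k _ _ h₁ h₂ => exact .impE (hK _ k) h₁ h₂
  | orI₁ k _ h => exact .orI₁ (hK _ k) h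
  | orI₂ k _ h => exact .orI₂ (hK _ k) h
  | orE k _ _ _ h₁ h₂ h₃ => exact .orE (hK _ k) h₁ h₂ h₃
  | botE k _ h => exact .botE (hK _ k) h
  | allI k _ h => exact .allI (hK _ k) h
  | allE k _ _ h₁ h₂ => exact .allE (hK _ k) h₁ h₂
  | exI k _ _ h₁ h₂ => exact .exI (hK _ k) h₁ h₂
  | exE k _ _ h₁ h₂ => exact .exE (hK _ k) h₁ h₂
  | eqI k _ h => exact .eqI (hK _ k) h
  | eqE k _ _ h₁ h₂ => exact .eqE (hK _ k) h₁ h₂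
  | ad k _ ht h => exact .ad (hK _ k) h ht

theorem ProvesWith.local {K : Pf S → Prop} {Γ p A} (h : ProvesWith K Γ p A) : K p := by
  cases h <;> assumption

theorem ProvesWith.premise {K : Pf S → Prop} {Γ p A} (h : ProvesWith K Γ p A) {i : ℕ} {q : Pf S}
    (hq : p.premises[i]? = some q) : ∃ Δ B, ProvesWith K Δ q B := by
  have hq := List.mem_of_getElem? hq
  cases h <;> simp only [Pf.premises, List.mem_cons, List.not_mem_nil, or_false] at hq <;>
    first
    | exact hq.elim
    | (rcases hq with rfl | rfl | rfl <;> exact ⟨_, _, by assumption⟩)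

theorem ProvesWith.sub {K : Pf S → Prop} {p q : Pf S} {a : List ℕ} (hq : p.Sub a q) :
    ∀ {Γ A}, ProvesWith K Γ p A → ∃ Δ B, ProvesWith K Δ q B := by
  induction hq with
  | nil p => exact fun h => ⟨_, _, h⟩
  | cons hi _ ih => exact fun h => (h.premise hi).elim fun _ ⟨_, h'⟩ => ih h'

/-- The renaming `ρ` of assumption classes leads from the context `Γ` to the context `Δ`. -/
def RenOK (Γ Δ : List (Fml S)) (ρ : ℕ → ℕ) : Prop :=
  ∀ i B, Γ[i]? = some B → Δ[ρ i]? = some B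

theorem RenOK.up {Γ Δ : List (Fml S)} {ρ : ℕ → ℕ} (h : RenOK Γ Δ ρ) (A : Fml S) :
    RenOK (A :: Γ) (A :: Δ) (upR ρ) := by
  intro i B hi
  cases i with
  | zero => simpa [upR] using hi
  | succ i => simpa [upR] using h i B (by simpa using hi)

theorem RenOK.map {Γ Δ : List (Fml S)} {ρ : ℕ → ℕ} (h : RenOK Γ Δ ρ) (f : Fml S → Fml S) :
    RenOK (Γ.map f) (Δ.map f) ρ := by
  intro i B hi
  rw [List.getElem?_map] at hi ⊢
  cases hΓ : Γ[i]? with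
  | none => simp [hΓ] at hi
  | some C => rw [h i C hΓ, ← hΓ]; exact hi

theorem renOK_succ (Γ : List (Fml S)) (A : Fml S) : RenOK Γ (A :: Γ) (fun n => n + 1) :=
  fun i B hi => by simpa using hi

theorem ProvesWith.ren {K : Pf S → Prop} (hK : ∀ p ρ, K p → K (p.ren ρ)) {Γ p A}
    (h : ProvesWith K Γ p A) :
    ∀ {Δ : List (Fml S)} {ρ : ℕ → ℕ}, RenOK Γ Δ ρ → ProvesWith K Δ (p.ren ρ) A := by
  induction h with
  | hyp i k h => exact fun hρ => .hyp _ (hK _ _ k) (hρ _ _ h)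
  | andI k _ _ h₁ h₂ => exact fun hρ => .andI (hK _ _ k) (h₁ hρ) (h₂ hρ)
  | andE₁ k _ h => exact fun hρ => .andE₁ (hK _ _ k) (h hρ)
  | andE₂ k _ h => exact fun hρ => .andE₂ (hK _ _ k) (h hρ)
  | impI k _ h => exact fun hρ => .impI (hK _ _ k) (h (hρ.up _))
  | impE k _ _ h₁ h₂ => exact fun hρ => .impE (hK _ _ k) (h₁ hρ) (h₂ hρ)
  | orI₁ k _ h => exact fun hρ => .orI₁ (hK _ _ k) (h hρ)
  | orI₂ k _ h => exact fun hρ => .orI₂ (hK _ _ k) (h hρ)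
  | orE k _ _ _ h₁ h₂ h₃ =>
    exact fun hρ => .orE (hK _ _ k) (h₁ hρ) (h₂ (hρ.up _)) (h₃ (hρ.up _))
  | botE k _ h => exact fun hρ => .botE (hK _ _ k) (h hρ)
  | allI k _ h => exact fun hρ => .allI (hK _ _ k) (h ((hρ.map _).up _))
  | allE k _ _ h₁ h₂ => exact fun hρ => .allE (hK _ _ k) (h₁ hρ) (h₂ hρ)
  | exI k _ _ h₁ h₂ => exact fun hρ => .exI (hK _ _ k) (h₁ hρ) (h₂ hρ)
  | exE k _ _ h₁ h₂ => exact fun hρ => .exE (hK _ _ k) (h₁ hρ) (h₂ (((hρ.map _).up _).up _))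
  | eqI k _ h => exact fun hρ => .eqI (hK _ _ k) (h hρ)
  | eqE k _ _ h₁ h₂ => exact fun hρ => .eqE (hK _ _ k) (h₁ hρ) (h₂ hρ)
  | ad k _ ht h => exact fun hρ => .ad (hK _ _ k) (h hρ) ht

/-- Terms can be substituted in deductions that satisfy `K` hereditarily if `K` is stable under the
substitutions in a class `I` that is closed under moving below binders. -/
theorem ProvesWith.substT {K : Pf S → Prop} {I : (ℕ → Tm S) → Prop}
    (hI : ∀ σ, I σ → I (upσ σ)) (hK : ∀ p σ, I σ → K p → K (p.substT σ)) {Γ p A}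
    (h : ProvesWith K Γ p A) : ∀ {σ : ℕ → Tm S}, I σ →
      ProvesWith K (Γ.map (Fml.subst σ)) (p.substT σ) (A.subst σ) := by
  induction h with
  | hyp i k h => exact fun hσ => .hyp _ (hK _ _ hσ k) (by rw [List.getElem?_map, h]; rfl)
  | andI k _ _ h₁ h₂ => exact fun hσ => .andI (hK _ _ hσ k) (h₁ hσ) (h₂ hσ)
  | andE₁ k _ h => exact fun hσ => .andE₁ (hK _ _ hσ k) (h hσ)
  | andE₂ k _ h => exact fun hσ => .andE₂ (hK _ _ hσ k) (h hσ)
  | impI k _ h => exact fun hσ => .impI (hK _ _ hσ k) (h hσ)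
  | impE k _ _ h₁ h₂ => exact fun hσ => .impE (hK _ _ hσ k) (h₁ hσ) (h₂ hσ)
  | orI₁ k _ h => exact fun hσ => .orI₁ (hK _ _ hσ k) (h hσ)
  | orI₂ k _ h => exact fun hσ => .orI₂ (hK _ _ hσ k) (h hσ)
  | orE k _ _ _ h₁ h₂ h₃ => exact fun hσ => .orE (hK _ _ hσ k) (h₁ hσ) (h₂ hσ) (h₃ hσ)
  | botE k _ h => exact fun hσ => .botE (hK _ _ hσ k) (h hσ)
  | allI k _ h =>
    intro σ hσ
    have h := h (hI _ hσ)
    rw [List.map_cons, map_shift_map_subst] at h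
    exact .allI (hK _ _ hσ k) h
  | allE k _ _ h₁ h₂ =>
    intro σ hσ
    rw [Fml.inst_subst]
    exact .allE (hK _ _ hσ k) (h₁ hσ) (h₂ hσ)
  | exI k _ _ h₁ h₂ =>
    intro σ hσ
    have h₁ := h₁ hσ
    rw [Fml.inst_subst] at h₁
    exact .exI (hK _ _ hσ k) h₁ (h₂ hσ)
  | exE k _ _ h₁ h₂ =>
    intro σ hσ
    have h₂ := h₂ (hI _ hσ)
    rw [List.map_cons, List.map_cons, map_shift_map_subst, Fml.shift_subst] at h₂
    exact .exE (hK _ _ hσ k) (h₁ hσ) h₂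
  | eqI k _ h => exact fun hσ => .eqI (hK _ _ hσ k) (h hσ)
  | eqE k _ _ h₁ h₂ =>
    intro σ hσ
    have h₂ := h₂ hσ
    rw [Fml.inst_subst] at h₂ ⊢
    exact .eqE (hK _ _ hσ k) (h₁ hσ) h₂
  | ad k _ ht h => exact fun hσ => .ad (hK _ _ hσ k) (h hσ) (ht.subst _)

/-! ### Transformations inside deductions -/

/-- Finitely many applications of the transformations `R` inside a deduction. -/
abbrev Steps (R : Pf S → Pf S → Prop) : Pf S → Pf S → Prop := Relation.ReflTransGen (Compat R)

namespace Steps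

variable {R : Pf S → Pf S → Prop} {p p' q q' r r' : Pf S}

theorem base (h : R p q) : Steps R p q := .single (.base h)

theorem andI (hp : Steps R p p') (hq : Steps R q q') : Steps R (.andI p q) (.andI p' q') :=
  (hp.lift (Pf.andI · q) fun _ _ => .andIl q).trans (hq.lift (Pf.andI p' ·) fun _ _ => .andIr p')

theorem andE₁ (hp : Steps R p p') : Steps R (.andE₁ p) (.andE₁ p') :=
  hp.lift Pf.andE₁ fun _ _ => .andE₁

theorem andE₂ (hp : Steps R p p') : Steps R (.andE₂ p) (.andE₂ p') :=
  hp.lift Pf.andE₂ fun _ _ => .andE₂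

theorem impI (A : Fml S) (hp : Steps R p p') : Steps R (.impI A p) (.impI A p') :=
  hp.lift (Pf.impI A) fun _ _ => .impI A

theorem impE (hp : Steps R p p') (hq : Steps R q q') : Steps R (.impE p q) (.impE p' q') :=
  (hp.lift (Pf.impE · q) fun _ _ => .impEl q).trans (hq.lift (Pf.impE p' ·) fun _ _ => .impEr p')

theorem orI₁ (B : Fml S) (hp : Steps R p p') : Steps R (.orI₁ B p) (.orI₁ B p') :=
  hp.lift (Pf.orI₁ B) fun _ _ => .orI₁ B

theorem orI₂ (A : Fml S) (hp : Steps R p p') : Steps R (.orI₂ A p) (.orI₂ A p') :=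
  hp.lift (Pf.orI₂ A) fun _ _ => .orI₂ A

theorem orE (hp : Steps R p p') (hq : Steps R q q') (hr : Steps R r r') :
    Steps R (.orE p q r) (.orE p' q' r') :=
  ((hp.lift (Pf.orE · q r) fun _ _ => .orEl q r).trans
    (hq.lift (Pf.orE p' · r) fun _ _ => .orEm p' r)).trans
    (hr.lift (Pf.orE p' q' ·) fun _ _ => .orEr p' q')

theorem botE (A : Fml S) (hp : Steps R p p') : Steps R (.botE A p) (.botE A p') :=
  hp.lift (Pf.botE A) fun _ _ => .botE A

theorem allI (hp : Steps R p p') : Steps R (.allI p) (.allI p') :=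
  hp.lift Pf.allI fun _ _ => .allI

theorem allE (t : Tm S) (hp : Steps R p p') (hq : Steps R q q') :
    Steps R (.allE t p q) (.allE t p' q') :=
  (hp.lift (Pf.allE t · q) fun _ _ => .allEl t q).trans
    (hq.lift (Pf.allE t p' ·) fun _ _ => .allEr t p')

theorem exI (A : Fml S) (t : Tm S) (hp : Steps R p p') (hq : Steps R q q') :
    Steps R (.exI A t p q) (.exI A t p' q') :=
  (hp.lift (Pf.exI A t · q) fun _ _ => .exIl A t q).trans
    (hq.lift (Pf.exI A t p' ·) fun _ _ => .exIr A t p')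

theorem exE (hp : Steps R p p') (hq : Steps R q q') : Steps R (.exE p q) (.exE p' q') :=
  (hp.lift (Pf.exE · q) fun _ _ => .exEl q).trans (hq.lift (Pf.exE p' ·) fun _ _ => .exEr p')

theorem eqI (hp : Steps R p p') : Steps R (.eqI p) (.eqI p') :=
  hp.lift Pf.eqI fun _ _ => .eqI

theorem eqE (A : Fml S) (s t : Tm S) (hp : Steps R p p') (hq : Steps R q q') :
    Steps R (.eqE A s t p q) (.eqE A s t p' q') :=
  (hp.lift (Pf.eqE A s t · q) fun _ _ => .eqEl A s t q).trans
    (hq.lift (Pf.eqE A s t p' ·) fun _ _ => .eqEr A s t p')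

theorem ad (A : Fml S) (t : Tm S) (hp : Steps R p p') : Steps R (.ad A t p) (.ad A t p') :=
  hp.lift (Pf.ad A t) fun _ _ => .ad A t

end Steps

/-! ### Restriction of `(=E)` and `(⊥E)` to prime conclusions -/

/-- If the last rule is `(=E)` or `(⊥E)`, its conclusion is prime. -/
def LocalRestricted : Pf S → Prop
  | .botE A _ => A.IsPrime
  | .eqE A _ _ _ _ => A.IsPrime
  | _ => True

theorem LocalRestricted.ren {p : Pf S} {ρ : ℕ → ℕ} (h : LocalRestricted p) :
    LocalRestricted (p.ren ρ) := by
  cases p <;> trivial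

theorem LocalRestricted.substT {p : Pf S} {σ : ℕ → Tm S} (h : LocalRestricted p) :
    LocalRestricted (p.substT σ) := by
  cases p <;> first | trivial | exact Fml.IsPrime.subst h _

theorem ProvesWith.restricted {Γ : List (Fml S)} {p A} (h : ProvesWith LocalRestricted Γ p A) :
    Restricted p where
  eqE a B s t q r hs := by
    obtain ⟨Δ, C, h⟩ := h.sub hs
    exact h.local
  botE a B q hs := by
    obtain ⟨Δ, C, h⟩ := h.sub hs
    exact h.local

theorem ProvesWith.wk_restricted {Γ : List (Fml S)} {p A} (h : ProvesWith LocalRestricted Γ p A)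
    (B : Fml S) : ProvesWith LocalRestricted (B :: Γ) p.wk A :=
  h.ren (fun _ _ => LocalRestricted.ren) (renOK_succ Γ B)

theorem ProvesWith.shift_restricted {Γ : List (Fml S)} {p A}
    (h : ProvesWith LocalRestricted Γ p A) :
    ProvesWith LocalRestricted (Γ.map Fml.shift) p.shift A.shift :=
  h.substT (I := fun _ => True) (fun _ _ => trivial) (fun _ _ _ => LocalRestricted.substT) trivial

theorem exists_restricted_botE (n : ℕ) : ∀ (A : Fml S), A.size ≤ n → ∀ {Γ p},
    ProvesWith LocalRestricted Γ p .bot →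
    ∃ p', Steps RestrictRule (.botE A p) p' ∧ ProvesWith LocalRestricted Γ p' A := by
  induction n with
  | zero =>
    intro A hA Γ p hp
    cases A with
    | rel R ts => exact ⟨_, .refl, .botE (.rel R ts) hp⟩
    | eq s t => exact ⟨_, .refl, .botE (.eq s t) hp⟩
    | exi t => exact ⟨_, .refl, .botE (.exi t) hp⟩
    | bot => exact ⟨_, .base (.botBot p), hp⟩
    | _ => simp [Fml.size] at hA
  | succ n ih =>
    intro A hA Γ p hp
    cases A with
    | rel R ts => exact ⟨_, .refl, .botE (.rel R ts) hp⟩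
    | eq s t => exact ⟨_, .refl, .botE (.eq s t) hp⟩
    | exi t => exact ⟨_, .refl, .botE (.exi t) hp⟩
    | bot => exact ⟨_, .base (.botBot p), hp⟩
    | and A B =>
      simp only [Fml.size] at hA
      obtain ⟨p₁, hs₁, h₁⟩ := ih A (by omega) hp
      obtain ⟨p₂, hs₂, h₂⟩ := ih B (by omega) hp
      exact ⟨_, (Steps.base (.botAnd A B p)).trans (hs₁.andI hs₂), .andI trivial h₁ h₂⟩
    | or A B =>
      simp only [Fml.size] at hA
      obtain ⟨p₁, hs₁, h₁⟩ := ih A (by omega) hp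
      exact ⟨_, (Steps.base (.botOr₁ A B p)).trans (hs₁.orI₁ B), .orI₁ trivial h₁⟩
    | imp A B =>
      simp only [Fml.size] at hA
      obtain ⟨p₁, hs₁, h₁⟩ := ih B (by omega) (hp.wk_restricted A)
      exact ⟨_, (Steps.base (.botImp A B p)).trans (hs₁.impI A), .impI trivial h₁⟩
    | all A =>
      simp only [Fml.size] at hA
      obtain ⟨p₁, hs₁, h₁⟩ := ih A (by omega) (hp.shift_restricted.wk_restricted (.exi (.var 0)))
      exact ⟨_, (Steps.base (.botAll A p)).trans hs₁.allI, .allI trivial h₁⟩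
    | ex A =>
      simp only [Fml.size] at hA
      -- any term may serve as the witness, since `∃!` of it follows from `⊥` as well
      obtain ⟨p₁, hs₁, h₁⟩ := ih (A.inst (.var 0)) (by rw [Fml.size_inst]; omega) hp
      exact ⟨_, (Steps.base (.botEx A (.var 0) p)).trans (hs₁.exI _ _ .refl),
        .exI trivial h₁ (.botE (.exi _) hp)⟩

theorem ProvesWith.symm_restricted {Γ : List (Fml S)} {s t p}
    (h : ProvesWith LocalRestricted Γ p (.eq s t)) :
    ProvesWith LocalRestricted Γ (Pf.symm s t p) (.eq t s) := by
  have e : ∀ w : Tm S, (Fml.eq (.var 0) s.shift).inst w = .eq w s := fun w =>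
    congrArg (Fml.eq w) (Tm.shift_inst s w)
  rw [← e t]
  refine .eqE (Fml.IsPrime.eq _ _) h ?_
  rw [e s]
  exact .eqI trivial (.ad trivial h (.eqLeft s t))

theorem exists_restricted_eqE (n : ℕ) : ∀ (A : Fml S), A.size ≤ n → ∀ {Γ s t p q},
    ProvesWith LocalRestricted Γ p (.eq s t) → ProvesWith LocalRestricted Γ q (A.inst s) →
    ∃ p', Steps RestrictRule (.eqE A s t p q) p' ∧
      ProvesWith LocalRestricted Γ p' (A.inst t) := by
  induction n with
  | zero =>
    intro A hA Γ s t p q hp hq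
    cases A with
    | rel R ts => exact ⟨_, .refl, .eqE (.rel R ts) hp hq⟩
    | eq s t => exact ⟨_, .refl, .eqE (.eq s t) hp hq⟩
    | exi t => exact ⟨_, .refl, .eqE (.exi t) hp hq⟩
    | bot => exact ⟨_, .base (.eqBot s t p q), hq⟩
    | _ => simp [Fml.size] at hA
  | succ n ih =>
    intro A hA Γ s t p q hp hq
    cases A with
    | rel R ts => exact ⟨_, .refl, .eqE (.rel R ts) hp hq⟩
    | eq s t => exact ⟨_, .refl, .eqE (.eq s t) hp hq⟩
    | exi t => exact ⟨_, .refl, .eqE (.exi t) hp hq⟩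
    | bot => exact ⟨_, .base (.eqBot s t p q), hq⟩
    | and A B =>
      simp only [Fml.size] at hA
      obtain ⟨p₁, hs₁, h₁⟩ := ih A (by omega) hp (.andE₁ trivial hq)
      obtain ⟨p₂, hs₂, h₂⟩ := ih B (by omega) hp (.andE₂ trivial hq)
      exact ⟨_, (Steps.base (.eqAnd A B s t p q)).trans (hs₁.andI hs₂), .andI trivial h₁ h₂⟩
    | or A B =>
      simp only [Fml.size] at hA
      obtain ⟨p₁, hs₁, h₁⟩ := ih A (by omega) (hp.wk_restricted (A.inst s)) (.hyp 0 trivial rfl)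
      obtain ⟨p₂, hs₂, h₂⟩ := ih B (by omega) (hp.wk_restricted (B.inst s)) (.hyp 0 trivial rfl)
      exact ⟨_, (Steps.base (.eqOr A B s t p q)).trans
          (Steps.orE .refl (hs₁.orI₁ (B.inst t)) (hs₂.orI₂ (A.inst t))),
        .orE trivial hq (.orI₁ trivial h₁) (.orI₂ trivial h₂)⟩
    | imp A B =>
      simp only [Fml.size] at hA
      obtain ⟨p₁, hs₁, h₁⟩ := ih A (by omega) (hp.wk_restricted (A.inst t)).symm_restricted
        (.hyp 0 trivial rfl)
      obtain ⟨p₂, hs₂, h₂⟩ := ih B (by omega) (hp.wk_restricted (A.inst t))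
        (.impE trivial (hq.wk_restricted (A.inst t)) h₁)
      refine ⟨_, (Steps.base (.eqImp A B s t p q)).trans (Steps.impI _ ?_), .impI trivial h₂⟩
      exact (Steps.eqE B s t .refl (.impE .refl hs₁)).trans hs₂
    | all A =>
      simp only [Fml.size] at hA
      have hq' : ProvesWith LocalRestricted (.exi (.var 0) :: Γ.map Fml.shift)
          (.allE (.var 0) q.shift.wk (.hyp 0)) ((A.subst swapσ).inst s.shift) := by
        have h := hq.shift_restricted.wk_restricted (.exi (.var 0))
        rw [Fml.swap_inst, ← Fml.upShift_inst (A.subst (upσ (instσ s)))]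
        exact .allE trivial h (.hyp 0 trivial rfl)
      obtain ⟨p₁, hs₁, h₁⟩ := ih (A.subst swapσ) (by rw [Fml.size_subst]; omega)
        (s := s.shift) (t := t.shift) (hp.shift_restricted.wk_restricted (.exi (.var 0))) hq'
      rw [Fml.swap_inst] at h₁
      exact ⟨_, (Steps.base (.eqAll A s t p q)).trans hs₁.allI, .allI trivial h₁⟩
    | ex A =>
      simp only [Fml.size] at hA
      obtain ⟨p₁, hs₁, h₁⟩ := ih (A.subst swapσ) (by rw [Fml.size_subst]; omega)
        (s := s.shift) (t := t.shift)
        ((hp.shift_restricted.wk_restricted (A.subst (upσ (instσ s)))).wk_restricted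
          (.exi (.var 0)))
        (.hyp 1 trivial (by rw [Fml.swap_inst]; rfl))
      rw [Fml.swap_inst, ← Fml.upShift_inst (A.subst (upσ (instσ t)))] at h₁
      exact ⟨_, (Steps.base (.eqEx A s t p q)).trans
          (Steps.exE .refl (hs₁.exI _ (.var 0) .refl)),
        .exE trivial hq (.exI trivial h₁ (.hyp 0 trivial rfl))⟩

theorem Proves.exists_restricted {Γ : List (Fml S)} {p A} (h : Proves Γ p A) :
    ∃ p', Steps RestrictRule p p' ∧ ProvesWith LocalRestricted Γ p' A := by
  induction h with
  | hyp i h => exact ⟨_, .refl, .hyp i trivial h⟩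
  | andI _ _ ih₁ ih₂ =>
    obtain ⟨⟨_, s₁, h₁⟩, ⟨_, s₂, h₂⟩⟩ := ih₁, ih₂
    exact ⟨_, s₁.andI s₂, .andI trivial h₁ h₂⟩
  | andE₁ _ ih =>
    obtain ⟨_, s, h⟩ := ih
    exact ⟨_, s.andE₁, .andE₁ trivial h⟩
  | andE₂ _ ih =>
    obtain ⟨_, s, h⟩ := ih
    exact ⟨_, s.andE₂, .andE₂ trivial h⟩
  | impI _ ih =>
    obtain ⟨_, s, h⟩ := ih
    exact ⟨_, s.impI _, .impI trivial h⟩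
  | impE _ _ ih₁ ih₂ =>
    obtain ⟨⟨_, s₁, h₁⟩, ⟨_, s₂, h₂⟩⟩ := ih₁, ih₂
    exact ⟨_, s₁.impE s₂, .impE trivial h₁ h₂⟩
  | orI₁ _ ih =>
    obtain ⟨_, s, h⟩ := ih
    exact ⟨_, s.orI₁ _, .orI₁ trivial h⟩
  | orI₂ _ ih =>
    obtain ⟨_, s, h⟩ := ih
    exact ⟨_, s.orI₂ _, .orI₂ trivial h⟩
  | orE _ _ _ ih₁ ih₂ ih₃ =>
    obtain ⟨⟨_, s₁, h₁⟩, ⟨_, s₂, h₂⟩, ⟨_, s₃, h₃⟩⟩ := ih₁, ih₂, ih₃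
    exact ⟨_, s₁.orE s₂ s₃, .orE trivial h₁ h₂ h₃⟩
  | botE _ ih =>
    obtain ⟨_, s, h⟩ := ih
    obtain ⟨p', s', h'⟩ := exists_restricted_botE _ _ le_rfl h
    exact ⟨p', (s.botE _).trans s', h'⟩
  | allI _ ih =>
    obtain ⟨_, s, h⟩ := ih
    exact ⟨_, s.allI, .allI trivial h⟩
  | allE _ _ ih₁ ih₂ =>
    obtain ⟨⟨_, s₁, h₁⟩, ⟨_, s₂, h₂⟩⟩ := ih₁, ih₂
    exact ⟨_, s₁.allE _ s₂, .allE trivial h₁ h₂⟩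
  | exI _ _ ih₁ ih₂ =>
    obtain ⟨⟨_, s₁, h₁⟩, ⟨_, s₂, h₂⟩⟩ := ih₁, ih₂
    exact ⟨_, s₁.exI _ _ s₂, .exI trivial h₁ h₂⟩
  | exE _ _ ih₁ ih₂ =>
    obtain ⟨⟨_, s₁, h₁⟩, ⟨_, s₂, h₂⟩⟩ := ih₁, ih₂
    exact ⟨_, s₁.exE s₂, .exE trivial h₁ h₂⟩
  | eqI _ ih =>
    obtain ⟨_, s, h⟩ := ih
    exact ⟨_, s.eqI, .eqI trivial h⟩
  | eqE _ _ ih₁ ih₂ =>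
    obtain ⟨⟨_, s₁, h₁⟩, ⟨_, s₂, h₂⟩⟩ := ih₁, ih₂
    obtain ⟨p', s', h'⟩ := exists_restricted_eqE _ _ le_rfl h₁ h₂
    exact ⟨p', (s₁.eqE _ _ _ s₂).trans s', h'⟩
  | ad _ ht ih =>
    obtain ⟨_, s, h⟩ := ih
    exact ⟨_, s.ad _ _, .ad trivial h ht⟩

/-! ### Normal deductions -/

/-- The deduction is an assumption or ends with `(∧E)`, `(→E)` or `(∀E)`. -/
def Pf.Neutral : Pf S → Prop
  | .hyp _ | .andE₁ _ | .andE₂ _ | .impE _ _ | .allE _ _ _ => True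
  | _ => False

theorem Pf.Neutral.not_orEx {p : Pf S} (h : p.Neutral) : ¬ p.EndsOrEx := by
  rintro (_ | _) <;> exact h

theorem Pf.Neutral.not_intro {p : Pf S} (h : p.Neutral) : ¬ p.EndsIntro := by
  rintro (_ | _) <;> exact h

theorem Pf.Neutral.not_eqE {p : Pf S} (h : p.Neutral) : ¬ p.EndsEqE := by
  rintro (_ | _) <;> exact h

theorem Pf.Neutral.not_eqI {p : Pf S} (h : p.Neutral) : ¬ p.EndsEqI := by
  rintro (_ | _) <;> exact h

theorem Pf.Neutral.not_adSelf {p : Pf S} (h : p.Neutral) : ¬ p.EndsADSelf := by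
  rintro (_ | _) <;> exact h

/-- Conditions on the last rule that hold throughout a deduction precisely if the deduction is
restricted and no reduction applies to it, apart from the removal of `(∨E)` and `(∃E)` with vacuous
discharge.  In a restricted deduction, a compound formula or `⊥` that is concluded neither by an
introduction rule nor by `(∨E)` or `(∃E)` has a neutral deduction. -/
def LocalNormal : Pf S → Prop
  | .andE₁ p => p.Neutral
  | .andE₂ p => p.Neutral
  | .impE p _ => p.Neutral
  | .orE p _ _ => p.Neutral
  | .botE A p => A.IsPrime ∧ p.Neutral
  | .allE _ p _ => p.Neutral
  | .exE p _ => p.Neutral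
  | .eqI p => ¬ p.EndsOrEx ∧ ¬ p.EndsADSelf
  | .eqE A s t p _ => A.IsPrime ∧ (∀ u, A ≠ .exi u) ∧ A.inst s ≠ A.inst t ∧ ¬ p.EndsOrEx
  | .ad _ _ p => ¬ p.EndsOrEx ∧ ¬ p.EndsEqI ∧ ¬ p.EndsEqE
  | _ => True

theorem LocalNormal.restricted : ∀ p : Pf S, LocalNormal p → LocalRestricted p := by
  intro p h
  cases p <;> first | trivial | exact h.1

/-- `NF Γ p A`: `p` is a restricted deduction of `A` from `Γ` without redexes other than
applications of `(∨E)` and `(∃E)` with vacuous discharge. -/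
abbrev NF : List (Fml S) → Pf S → Fml S → Prop := ProvesWith LocalNormal

theorem Pf.Neutral.ren {p : Pf S} (h : p.Neutral) (ρ : ℕ → ℕ) : (p.ren ρ).Neutral := by
  cases p <;> exact h

theorem Pf.Neutral.substT {p : Pf S} (h : p.Neutral) (σ : ℕ → Tm S) : (p.substT σ).Neutral := by
  cases p <;> exact h

theorem Pf.EndsOrEx.of_ren {p : Pf S} {ρ : ℕ → ℕ} (h : (p.ren ρ).EndsOrEx) : p.EndsOrEx := by
  cases p <;> first | constructor | cases h

theorem Pf.EndsOrEx.of_substT {p : Pf S} {σ : ℕ → Tm S} (h : (p.substT σ).EndsOrEx) :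
    p.EndsOrEx := by
  cases p <;> first | constructor | cases h

theorem Pf.EndsEqI.of_ren {p : Pf S} {ρ : ℕ → ℕ} (h : (p.ren ρ).EndsEqI) : p.EndsEqI := by
  cases p <;> first | constructor | cases h

theorem Pf.EndsEqI.of_substT {p : Pf S} {σ : ℕ → Tm S} (h : (p.substT σ).EndsEqI) :
    p.EndsEqI := by
  cases p <;> first | constructor | cases h

theorem Pf.EndsEqE.of_ren {p : Pf S} {ρ : ℕ → ℕ} (h : (p.ren ρ).EndsEqE) : p.EndsEqE := by
  cases p <;> first | constructor | cases h

theorem Pf.EndsEqE.of_substT {p : Pf S} {σ : ℕ → Tm S} (h : (p.substT σ).EndsEqE) :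
    p.EndsEqE := by
  cases p <;> first | constructor | cases h

theorem Pf.EndsADSelf.of_ren {p : Pf S} {ρ : ℕ → ℕ} (h : (p.ren ρ).EndsADSelf) :
    p.EndsADSelf := by
  cases p <;> cases h
  constructor

theorem Pf.EndsADSelf.of_substT {p : Pf S} {σ : ℕ → Tm S} (hσ : LeftInv σ)
    (h : (p.substT σ).EndsADSelf) : p.EndsADSelf := by
  cases p with
  | ad A t p =>
    cases A with
    | eq a b =>
      have h' : ∀ {A : Fml S} {w q}, (Pf.ad A w q).EndsADSelf → A = .eq w w := by
        rintro _ _ _ ⟨⟩; rfl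
      have e := h' h
      simp only [Fml.subst, Fml.eq.injEq] at e
      obtain rfl := hσ.tm_injective e.1
      obtain rfl := hσ.tm_injective e.2
      constructor
    | _ => cases h
  | _ => cases h

theorem LocalNormal.ren : ∀ (p : Pf S) (ρ : ℕ → ℕ), LocalNormal p → LocalNormal (p.ren ρ) := by
  intro p ρ h
  cases p with
  | andE₁ p => exact Pf.Neutral.ren h ρ
  | andE₂ p => exact Pf.Neutral.ren h ρ
  | impE p q => exact Pf.Neutral.ren h ρ
  | orE p q r => exact Pf.Neutral.ren h ρ
  | botE A p => exact ⟨h.1, h.2.ren ρ⟩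
  | allE t p q => exact Pf.Neutral.ren h ρ
  | exE p q => exact Pf.Neutral.ren h ρ
  | eqI p => exact ⟨fun h' => h.1 h'.of_ren, fun h' => h.2 h'.of_ren⟩
  | eqE A s t p q => exact ⟨h.1, h.2.1, h.2.2.1, fun h' => h.2.2.2 h'.of_ren⟩
  | ad A t p => exact ⟨fun h' => h.1 h'.of_ren, fun h' => h.2.1 h'.of_ren,
      fun h' => h.2.2 h'.of_ren⟩
  | _ => trivial

theorem Fml.subst_ne_exi {A : Fml S} (h : ∀ u, A ≠ .exi u) (σ : ℕ → Tm S) (u : Tm S) :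
    A.subst σ ≠ .exi u := by
  cases A with
  | exi w => exact absurd rfl (h w)
  | _ => exact nofun

theorem Fml.inst_subst_ne {A : Fml S} {s t : Tm S} {σ : ℕ → Tm S} (hσ : LeftInv σ)
    (h : A.inst s ≠ A.inst t) :
    (A.subst (upσ σ)).inst (s.subst σ) ≠ (A.subst (upσ σ)).inst (t.subst σ) := by
  rw [← Fml.inst_subst, ← Fml.inst_subst]
  exact fun e => h (hσ.fml_injective e)

theorem LocalNormal.substT : ∀ (p : Pf S) (σ : ℕ → Tm S), LeftInv σ → LocalNormal p →
    LocalNormal (p.substT σ) := by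
  intro p σ hσ h
  cases p with
  | andE₁ p => exact Pf.Neutral.substT h σ
  | andE₂ p => exact Pf.Neutral.substT h σ
  | impE p q => exact Pf.Neutral.substT h σ
  | orE p q r => exact Pf.Neutral.substT h σ
  | botE A p => exact ⟨h.1.subst σ, h.2.substT σ⟩
  | allE t p q => exact Pf.Neutral.substT h σ
  | exE p q => exact Pf.Neutral.substT h σ
  | eqI p => exact ⟨fun h' => h.1 h'.of_substT, fun h' => h.2 (h'.of_substT hσ)⟩
  | eqE A s t p q =>
    exact ⟨h.1.subst _, Fml.subst_ne_exi h.2.1 _, Fml.inst_subst_ne hσ h.2.2.1,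
      fun h' => h.2.2.2 h'.of_substT⟩
  | ad A t p =>
    exact ⟨fun h' => h.1 h'.of_substT, fun h' => h.2.1 h'.of_substT, fun h' => h.2.2 h'.of_substT⟩
  | _ => trivial

theorem NF.ren {Γ Δ : List (Fml S)} {p A ρ} (h : NF Γ p A) (hρ : RenOK Γ Δ ρ) :
    NF Δ (p.ren ρ) A :=
  ProvesWith.ren LocalNormal.ren h hρ

theorem NF.wk {Γ : List (Fml S)} {p A} (h : NF Γ p A) (B : Fml S) : NF (B :: Γ) p.wk A :=
  h.ren (renOK_succ Γ B)

theorem NF.substT {Γ : List (Fml S)} {p A σ} (h : NF Γ p A) (hσ : LeftInv σ) :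
    NF (Γ.map (Fml.subst σ)) (p.substT σ) (A.subst σ) :=
  ProvesWith.substT (I := LeftInv) (fun _ => LeftInv.up) LocalNormal.substT h hσ

theorem NF.shift {Γ : List (Fml S)} {p A} (h : NF Γ p A) : NF (Γ.map Fml.shift) p.shift A.shift :=
  h.substT leftInv_shiftσ

/-! ### Rules applied to normal deductions -/

/-- `NFFrame Γ F B C`: the frame `F` leads from a deduction of `B` from `Γ` to one of `C`, its
other premises have normal deductions, and it is not itself a redex, whatever its open premise. -/
inductive NFFrame : List (Fml S) → Frame S → Fml S → Fml S → Prop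
  | andE₁ {Γ A B} : NFFrame Γ .andE₁ (.and A B) A
  | andE₂ {Γ A B} : NFFrame Γ .andE₂ (.and A B) B
  | impE {Γ A B q} : NF Γ q A → NFFrame Γ (.impE q) (.imp A B) B
  | orE {Γ A B C q r} : NF (A :: Γ) q C → NF (B :: Γ) r C → NFFrame Γ (.orE q r) (.or A B) C
  | botE {Γ A} : A.IsPrime → NFFrame Γ (.botE A) .bot A
  | allE {Γ A t q} : NF Γ q (.exi t) → NFFrame Γ (.allE t q) (.all A) (A.inst t)
  | exE {Γ A C q} : NF (.exi (.var 0) :: A :: Γ.map Fml.shift) q C.shift →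
      NFFrame Γ (.exE q) (.ex A) C
  | eqE {Γ A s t q} : A.IsPrime → (∀ u, A ≠ .exi u) → A.inst s ≠ A.inst t → NF Γ q (A.inst s) →
      NFFrame Γ (.eqE A s t q) (.eq s t) (A.inst t)
  | eqI {Γ t} : NFFrame Γ .eqI (.exi t) (.eq t t)
  | ad {Γ A t} : A.HasTerm t → NFFrame Γ (.ad A t) A (.exi t)

theorem NFFrame.wk {Γ : List (Fml S)} {F B C} (h : NFFrame Γ F B C) (D : Fml S) :
    NFFrame (D :: Γ) F.wk B C := by
  cases h with
  | andE₁ => exact .andE₁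
  | andE₂ => exact .andE₂
  | impE hq => exact .impE (hq.wk D)
  | orE hq hr => exact .orE (hq.ren ((renOK_succ Γ D).up _)) (hr.ren ((renOK_succ Γ D).up _))
  | botE hA => exact .botE hA
  | allE hq => exact .allE (hq.wk D)
  | exE hq => exact .exE (hq.ren (((renOK_succ _ _).up _).up _))
  | eqE h₁ h₂ h₃ hq => exact .eqE h₁ h₂ h₃ (hq.wk D)
  | eqI => exact .eqI
  | ad ht => exact .ad ht

theorem NFFrame.shift {Γ : List (Fml S)} {F B C} (h : NFFrame Γ F B C) :
    NFFrame (Γ.map Fml.shift) F.shift B.shift C.shift := by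
  cases h with
  | andE₁ => exact .andE₁
  | andE₂ => exact .andE₂
  | impE hq => exact .impE hq.shift
  | orE hq hr => exact .orE hq.shift hr.shift
  | botE hA => exact .botE (hA.subst _)
  | allE hq =>
    rw [Fml.shift, Fml.shift, Fml.inst_subst]
    exact .allE hq.shift
  | exE hq =>
    have hq := hq.substT leftInv_shiftσ.up
    rw [List.map_cons, List.map_cons, map_shift_map_subst, Fml.shift_subst] at hq
    exact .exE hq
  | eqE h₁ h₂ h₃ hq =>
    have hq := hq.shift
    rw [Fml.shift, Fml.inst_subst] at hq
    rw [Fml.shift, Fml.shift, Fml.inst_subst]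
    exact .eqE (h₁.subst _) (Fml.subst_ne_exi h₂ _) (Fml.inst_subst_ne leftInv_shiftσ h₃) hq
  | eqI => exact .eqI
  | ad ht => exact .ad (ht.subst _)

theorem NFFrame.plug_neutral {Γ : List (Fml S)} {F B C p} (hF : NFFrame Γ F B C) (hp : NF Γ p B)
    (h : p.Neutral) : NF Γ (F.plug p) C := by
  cases hF with
  | andE₁ => exact .andE₁ h hp
  | andE₂ => exact .andE₂ h hp
  | impE hq => exact .impE h hp hq
  | orE hq hr => exact .orE h hp hq hr
  | botE hA => exact .botE ⟨hA, h⟩ hp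
  | allE hq => exact .allE h hp hq
  | exE hq => exact .exE h hp hq
  | eqE h₁ h₂ h₃ hq => exact .eqE ⟨h₁, h₂, h₃, h.not_orEx⟩ hp hq
  | eqI => exact .eqI ⟨h.not_orEx, h.not_adSelf⟩ hp
  | ad ht => exact .ad ⟨h.not_orEx, h.not_eqI, h.not_eqE⟩ hp ht

theorem NFFrame.plug_prime {Γ : List (Fml S)} {F B C p} (hF : NFFrame Γ F B C) (hp : NF Γ p B)
    (hB : B.IsPrime) (h : ¬ p.EndsOrEx) (h₁ : ¬ p.EndsADSelf) (h₂ : ¬ p.EndsEqI)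
    (h₃ : ¬ p.EndsEqE) : NF Γ (F.plug p) C := by
  cases hF with
  | eqE h₁ h₂ h₃ hq => exact .eqE ⟨h₁, h₂, h₃, h⟩ hp hq
  | eqI => exact .eqI ⟨h, h₁⟩ hp
  | ad ht => exact .ad ⟨h, h₂, h₃⟩ hp ht
  | _ => cases hB

/-! ### Hereditary substitution -/

/-- `p` reduces to a normal deduction of `A` from `Γ`. -/
def Normalizes (Γ : List (Fml S)) (p : Pf S) (A : Fml S) : Prop :=
  ∃ p', Steps RedRule p p' ∧ NF Γ p' A

theorem Normalizes.of_nf {Γ : List (Fml S)} {p A} (h : NF Γ p A) : Normalizes Γ p A := ⟨p, .refl, h⟩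

theorem Normalizes.of_step {Γ : List (Fml S)} {p q A} (h : RedRule p q) (hq : Normalizes Γ q A) :
    Normalizes Γ p A :=
  hq.imp fun _ hq => ⟨(Steps.base h).trans hq.1, hq.2⟩

/-- Terms `σ` and normal deductions `τ` are substituted for the parameters and assumptions of
deductions from `Γ`, so that deductions from `Δ` result.  The deductions that are not neutral
conclude formulas of size at most `n`. -/
def SubstOK (n : ℕ) (Γ Δ : List (Fml S)) (σ : ℕ → Tm S) (τ : ℕ → Pf S) : Prop :=
  ∀ i B, Γ[i]? = some B → NF Δ (τ i) (B.subst σ) ∧ ((τ i).Neutral ∨ B.size ≤ n)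

theorem SubstOK.up {n : ℕ} {Γ Δ : List (Fml S)} {σ : ℕ → Tm S} {τ : ℕ → Pf S}
    (h : SubstOK n Γ Δ σ τ) (A : Fml S) : SubstOK n (A :: Γ) (A.subst σ :: Δ) σ (upH τ) := by
  intro i B hi
  cases i with
  | zero =>
    obtain rfl : A = B := by simpa using hi
    exact ⟨.hyp 0 trivial rfl, .inl trivial⟩
  | succ i =>
    have h := h i B (by simpa using hi)
    exact ⟨h.1.wk _, h.2.imp_left fun h => h.ren _⟩

theorem SubstOK.shift {n : ℕ} {Γ Δ : List (Fml S)} {σ : ℕ → Tm S} {τ : ℕ → Pf S}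
    (h : SubstOK n Γ Δ σ τ) :
    SubstOK n (Γ.map Fml.shift) (Δ.map Fml.shift) (upσ σ) (fun i => (τ i).shift) := by
  intro i B hi
  rw [List.getElem?_map, Option.map_eq_some_iff] at hi
  obtain ⟨C, hC, rfl⟩ := hi
  have h := h i C hC
  rw [Fml.shift_subst, show C.shift.size = C.size from C.size_subst _]
  exact ⟨h.1.shift, h.2.imp_left fun h => h.substT _⟩

/-- Substitution of terms, and of normal deductions of formulas of size at most `n`, in a normal
deduction results in a normalizing deduction.  A neutral deduction turns into a neutral one unless
its conclusion is of size at most `n`: then the normal deduction may end with an introduction, or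
with `(∨E)` or `(∃E)`. -/
def SubstNormalizes (S : Sig.{u, v}) (n : ℕ) : Prop :=
  ∀ (Γ : List (Fml S)) (p : Pf S) (A : Fml S), NF Γ p A → ∀ Δ σ τ, SubstOK n Γ Δ σ τ →
    ∃ p', Steps RedRule ((p.substT σ).substH τ) p' ∧ NF Δ p' (A.subst σ) ∧
      (p.Neutral → p'.Neutral ∨ A.size ≤ n)

theorem SubstNormalizes.normalizes {n : ℕ} (hn : SubstNormalizes S n) {Γ Δ : List (Fml S)}
    {p A σ τ} (hp : NF Γ p A) (h : SubstOK n Γ Δ σ τ) :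
    Normalizes Δ ((p.substT σ).substH τ) (A.subst σ) :=
  (hn _ _ _ hp _ _ _ h).imp fun _ h => ⟨h.1, h.2.1⟩

theorem SubstNormalizes.inst₁ {n : ℕ} (hn : SubstNormalizes S n) {Γ : List (Fml S)} {p q A B}
    (hp : NF (A :: Γ) p B) (hq : NF Γ q A) (hA : A.size ≤ n) : Normalizes Γ (p.inst₁ q) B := by
  have h := hn.normalizes (Δ := Γ) (σ := Tm.var) (τ := fun | 0 => q | n + 1 => .hyp n) hp <| by
    intro i C hi
    rw [Fml.subst_var]
    cases i with
    | zero =>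
      obtain rfl : A = C := by simpa using hi
      exact ⟨hq, .inr hA⟩
    | succ i => exact ⟨.hyp i trivial (by simpa using hi), .inl trivial⟩
  rwa [Pf.substT_var, Fml.subst_var] at h

theorem getElem?_map_shift {Γ : List (Fml S)} {i : ℕ} {C : Fml S}
    (h : (Γ.map Fml.shift)[i]? = some C) (t : Tm S) : Γ[i]? = some (C.inst t) := by
  rw [List.getElem?_map, Option.map_eq_some_iff] at h
  obtain ⟨D, hD, rfl⟩ := h
  rw [hD, Fml.shift_inst]

theorem SubstNormalizes.all {n : ℕ} (hn : SubstNormalizes S n) {Γ : List (Fml S)} {p q A t}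
    (hp : NF (.exi (.var 0) :: Γ.map Fml.shift) p A) (hq : NF Γ q (.exi t)) :
    Normalizes Γ ((p.substT (instσ t)).inst₁ q) (A.inst t) :=
  hn.normalizes hp <| by
    intro i C hi
    cases i with
    | zero =>
      obtain rfl : .exi (.var 0) = C := by simpa using hi
      exact ⟨hq, .inr (Nat.zero_le n)⟩
    | succ i =>
      exact ⟨.hyp i trivial (getElem?_map_shift (by simpa using hi) t), .inl trivial⟩

theorem SubstNormalizes.ex {n : ℕ} (hn : SubstNormalizes S n) {Γ : List (Fml S)} {p q r A C t}
    (hp : NF Γ p (A.inst t)) (hq : NF Γ q (.exi t))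
    (hr : NF (.exi (.var 0) :: A :: Γ.map Fml.shift) r C.shift) (hA : A.size ≤ n) :
    Normalizes Γ ((r.substT (instσ t)).inst₂ q p) C := by
  rw [← Fml.shift_inst C t]
  refine hn.normalizes hr ?_
  intro i B hi
  match i with
  | 0 =>
    obtain rfl : .exi (.var 0) = B := by simpa using hi
    exact ⟨hq, .inr (Nat.zero_le n)⟩
  | 1 =>
    obtain rfl : A = B := by simpa using hi
    exact ⟨hp, .inr hA⟩
  | i + 2 =>
    exact ⟨.hyp i trivial (getElem?_map_shift (by simpa using hi) t), .inl trivial⟩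

theorem Fml.HasTerm.of_inst {A : Fml S} {s t w : Tm S} (h : (A.inst t).HasTerm w) (hs : w ≠ t) :
    (A.inst s).HasTerm w := by
  have key : ∀ x : Tm S, x.subst (instσ t) ≠ t → x.subst (instσ s) = x.subst (instσ t) := by
    intro x hx
    match x with
    | .const c => rfl
    | .var 0 => exact absurd rfl hx
    | .var (n + 1) => rfl
  cases A with
  | rel R ts =>
    obtain ⟨i, rfl⟩ : ∃ i, w = (ts i).subst (instσ t) := by
      generalize hB : (Fml.rel R ts).inst t = B at h
      cases h with
      | rel R' ts' i =>
        obtain ⟨rfl, h⟩ := Fml.rel.inj hB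
        cases h
        exact ⟨i, rfl⟩
      | _ => cases hB
    rw [← key _ hs]
    exact .rel R (fun i => (ts i).subst (instσ s)) i
  | eq a b =>
    cases h with
    | eqLeft =>
      rw [← key _ hs]
      exact .eqLeft _ _
    | eqRight =>
      rw [← key _ hs]
      exact .eqRight _ _
  | _ => cases h

/-- A rule applied to a normal deduction results in a normalizing deduction.  Permutations move the
rule upwards, through the minor premises of `(∨E)` and `(∃E)`; then an introduction may be met, and
normal deductions of smaller formulas are substituted in a normal deduction. -/
theorem NF.normalizes_plug {n : ℕ} (hn : ∀ m < n, SubstNormalizes S m) {Γ : List (Fml S)} {p B}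
    (hp : NF Γ p B) : B.size ≤ n → ∀ {F C}, NFFrame Γ F B C → Normalizes Γ (F.plug p) C := by
  induction hp with
  | hyp i k h => exact fun _ _ _ hF => .of_nf (hF.plug_neutral (.hyp i k h) trivial)
  | andE₁ k h => exact fun _ _ _ hF => .of_nf (hF.plug_neutral (.andE₁ k h) trivial)
  | andE₂ k h => exact fun _ _ _ hF => .of_nf (hF.plug_neutral (.andE₂ k h) trivial)
  | impE k h₁ h₂ => exact fun _ _ _ hF => .of_nf (hF.plug_neutral (.impE k h₁ h₂) trivial)
  | allE k h₁ h₂ => exact fun _ _ _ hF => .of_nf (hF.plug_neutral (.allE k h₁ h₂) trivial)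
  | @andI Γ A B p q k h₁ h₂ =>
    intro hB F C hF
    cases hF with
    | andE₁ => exact .of_step (.and₁ p q) (.of_nf h₁)
    | andE₂ => exact .of_step (.and₂ p q) (.of_nf h₂)
    | ad ht => cases ht
  | @impI Γ A B p k h =>
    intro hB F C hF
    simp only [Fml.size] at hB
    cases hF with
    | impE hq => exact .of_step (.imp A p _) ((hn A.size (by omega)).inst₁ h hq le_rfl)
    | ad ht => cases ht
  | @orI₁ Γ A B p k h =>
    intro hB F C hF
    simp only [Fml.size] at hB
    cases hF with
    | orE hq hr => exact .of_step (.or₁ B p _ _) ((hn A.size (by omega)).inst₁ hq h le_rfl)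
    | ad ht => cases ht
  | @orI₂ Γ A B p k h =>
    intro hB F C hF
    simp only [Fml.size] at hB
    cases hF with
    | orE hq hr => exact .of_step (.or₂ A p _ _) ((hn B.size (by omega)).inst₁ hr h le_rfl)
    | ad ht => cases ht
  | @allI Γ A p k h =>
    intro hB F C hF
    simp only [Fml.size] at hB
    cases hF with
    | allE hq => exact .of_step (.all _ p _) ((hn 0 (by omega)).all h hq)
    | ad ht => cases ht
  | @exI Γ A t p q k h₁ h₂ =>
    intro hB F C hF
    simp only [Fml.size] at hB
    cases hF with
    | exE hr => exact .of_step (.ex A t p q _) ((hn A.size (by omega)).ex h₁ h₂ hr le_rfl)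
    | ad ht => cases ht
  | @orE Γ A B D p q r k h₁ h₂ h₃ _ ih₂ ih₃ =>
    intro hB F C hF
    obtain ⟨q', hs₂, hq⟩ := ih₂ hB (hF.wk A)
    obtain ⟨r', hs₃, hr⟩ := ih₃ hB (hF.wk B)
    exact .of_step (.permOr F p q r) ⟨_, Steps.orE .refl hs₂ hs₃, .orE k h₁ hq hr⟩
  | @exE Γ A D p q k h₁ h₂ _ ih₂ =>
    intro hB F C hF
    obtain ⟨q', hs, hq⟩ := ih₂ (by rwa [Fml.shift, Fml.size_subst])
      ((hF.shift.wk A).wk (.exi (.var 0)))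
    exact .of_step (.permEx F p q) ⟨_, Steps.exE .refl hs, .exE k h₁ hq⟩
  | botE k h =>
    intro hB F C hF
    exact .of_nf (hF.plug_prime (.botE k h) k.1 nofun nofun nofun nofun)
  | @eqI Γ t p k h =>
    intro hB F C hF
    cases hF with
    -- the major premise is `t = t`, so the application of `(=E)` would be vacuous
    | eqE _ _ h₃ => exact absurd rfl h₃
    | ad ht =>
      generalize hA : Fml.eq t t = A at ht
      cases ht <;> cases hA <;> exact .of_step (.maxEq _ p) (.of_nf h)
  | @eqE Γ A s t p q k h₁ h₂ ih₁ ih₂ =>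
    intro hB F C hF
    have hpq : NF Γ (.eqE A s t p q) (A.inst t) := .eqE k h₁ h₂
    generalize hA : A.inst t = A' at hF hpq
    cases hF with
    | eqE k₁ k₂ k₃ hq => exact .of_nf (.eqE ⟨k₁, k₂, k₃, nofun⟩ hpq hq)
    | eqI => exact absurd hA (Fml.subst_ne_exi k.2.1 _ _)
    | @ad _ w ht =>
      -- `(AD)` moves to one of the two premises of `(=E)`, whose conclusions are prime as well
      subst hA
      by_cases hw : w = s ∨ w = t
      · refine .of_step (.adMajor A _ s t w p q hw) (ih₁ (Nat.zero_le n) (.ad ?_))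
        rcases hw with rfl | rfl
        · exact .eqLeft _ _
        · exact .eqRight _ _
      · rw [not_or] at hw
        rw [Fml.size_inst] at hB ih₂
        exact .of_step (.adMinor A _ s t w p q hw.1 hw.2) (ih₂ hB (.ad (ht.of_inst hw.2)))
    | _ =>
      have hA' : (A.inst t).IsPrime := k.1.subst _
      rw [hA] at hA'
      cases hA'
  | @ad Γ A t p k h ht =>
    intro hB F C hF
    by_cases hs : (Pf.ad A t p).EndsADSelf
    · cases hs with
      | ad t p =>
        cases hF with
        | eqI => exact .of_step (.maxExi t p) (.of_nf h)
        | ad ht => cases ht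
    · exact .of_nf (hF.plug_prime (.ad k h ht) (.exi t) nofun hs nofun nofun)

theorem Fml.inst_exi_eq {u s t : Tm S} (h : (Fml.exi u).inst s ≠ (Fml.exi u).inst t) :
    u = .var 0 := by
  match u with
  | .const c => exact absurd rfl h
  | .var 0 => rfl
  | .var (n + 1) => exact absurd rfl h

theorem NF.normalizes_eqE {Γ : List (Fml S)} {A s t p q} (hA : A.IsPrime) (hp : NF Γ p (.eq s t))
    (hq : NF Γ q (A.inst s)) : Normalizes Γ (.eqE A s t p q) (A.inst t) := by
  have hF : ∀ {F C}, NFFrame Γ F (.eq s t) C → Normalizes Γ (F.plug p) C :=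
    hp.normalizes_plug (n := 0) (fun m hm => absurd hm (Nat.not_lt_zero m)) le_rfl
  by_cases h : A.inst s = A.inst t
  · exact .of_step (.vacEqE A s t p q h) (h ▸ .of_nf hq)
  · by_cases hu : ∃ u, A = .exi u
    · obtain ⟨u, rfl⟩ := hu
      obtain rfl := Fml.inst_exi_eq h
      exact .of_step (.eqEExi s t p q) (hF (.ad (.eqRight s t)))
    · exact hF (.eqE hA (fun u hA => hu ⟨u, hA⟩) h hq)

theorem NF.exists_plug {n : ℕ} (hn : ∀ m < n, SubstNormalizes S m) {Γ : List (Fml S)} {p F B C}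
    (hp : NF Γ p B) (hF : NFFrame Γ F B C) (h : p.Neutral ∨ B.size ≤ n) :
    ∃ p', Steps RedRule (F.plug p) p' ∧ NF Γ p' C ∧ (p' = F.plug p ∨ B.size ≤ n) := by
  rcases h with h | h
  · exact ⟨_, .refl, hF.plug_neutral hp h, .inl rfl⟩
  · obtain ⟨p', hs, hp'⟩ := hp.normalizes_plug hn h hF
    exact ⟨p', hs, hp', .inr h⟩

/-- Hereditary substitution: by induction on `n` and on the deduction in which deductions are
substituted. -/
theorem substNormalizes (n : ℕ) : SubstNormalizes S n := by
  induction n using Nat.strong_induction_on with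
  | _ n hn =>
  intro Γ p A hp
  induction hp with
  | hyp i k h => exact fun Δ σ τ hτ => ⟨τ i, .refl, (hτ i _ h).1, fun _ => (hτ i _ h).2⟩
  | andI _ _ _ ih₁ ih₂ =>
    intro Δ σ τ hτ
    obtain ⟨⟨_, s₁, h₁, -⟩, ⟨_, s₂, h₂, -⟩⟩ := ih₁ _ _ _ hτ, ih₂ _ _ _ hτ
    exact ⟨_, s₁.andI s₂, .andI trivial h₁ h₂, False.elim⟩
  | @andE₁ Γ A B p k _ ih =>
    intro Δ σ τ hτ
    obtain ⟨p', s, h, hne⟩ := ih _ _ _ hτ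
    obtain ⟨r, s', h', hr⟩ := h.exists_plug hn .andE₁ (by simpa [Fml.size_subst] using hne k)
    refine ⟨r, s.andE₁.trans s', h', fun _ => hr.imp (fun e => by subst e; trivial) fun hr => ?_⟩
    simp only [Fml.size, Fml.size_subst] at hr
    omega
  | @andE₂ Γ A B p k _ ih =>
    intro Δ σ τ hτ
    obtain ⟨p', s, h, hne⟩ := ih _ _ _ hτ
    obtain ⟨r, s', h', hr⟩ := h.exists_plug hn .andE₂ (by simpa [Fml.size_subst] using hne k)
    refine ⟨r, s.andE₂.trans s', h', fun _ => hr.imp (fun e => by subst e; trivial) fun hr => ?_⟩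
    simp only [Fml.size, Fml.size_subst] at hr
    omega
  | impI _ _ ih =>
    intro Δ σ τ hτ
    obtain ⟨_, s, h, -⟩ := ih _ _ _ (hτ.up _)
    exact ⟨_, s.impI _, .impI trivial h, False.elim⟩
  | @impE Γ A B p q k _ _ ih₁ ih₂ =>
    intro Δ σ τ hτ
    obtain ⟨⟨p', s₁, h₁, hne⟩, ⟨q', s₂, h₂, -⟩⟩ := ih₁ _ _ _ hτ, ih₂ _ _ _ hτ
    obtain ⟨r, s', h', hr⟩ := h₁.exists_plug hn (.impE h₂)
      (by simpa [Fml.size_subst] using hne k)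
    refine ⟨r, (s₁.impE s₂).trans s', h', fun _ => hr.imp (fun e => by subst e; trivial) fun hr => ?_⟩
    simp only [Fml.size, Fml.size_subst] at hr
    omega
  | orI₁ _ _ ih =>
    intro Δ σ τ hτ
    obtain ⟨_, s, h, -⟩ := ih _ _ _ hτ
    exact ⟨_, s.orI₁ _, .orI₁ trivial h, False.elim⟩
  | orI₂ _ _ ih =>
    intro Δ σ τ hτ
    obtain ⟨_, s, h, -⟩ := ih _ _ _ hτ
    exact ⟨_, s.orI₂ _, .orI₂ trivial h, False.elim⟩
  | orE k _ _ _ ih₁ ih₂ ih₃ =>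
    intro Δ σ τ hτ
    obtain ⟨⟨_, s₁, h₁, hne⟩, ⟨_, s₂, h₂, -⟩, ⟨_, s₃, h₃, -⟩⟩ :=
      ih₁ _ _ _ hτ, ih₂ _ _ _ (hτ.up _), ih₃ _ _ _ (hτ.up _)
    obtain ⟨r, s', h', -⟩ := h₁.exists_plug hn (.orE h₂ h₃)
      (by simpa [Fml.size_subst] using hne k)
    exact ⟨r, (s₁.orE s₂ s₃).trans s', h', False.elim⟩
  | botE k _ ih =>
    intro Δ σ τ hτ
    obtain ⟨_, s, h, -⟩ := ih _ _ _ hτ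
    obtain ⟨r, s', h'⟩ := h.normalizes_plug hn (Nat.zero_le n) (.botE (k.1.subst σ))
    exact ⟨r, (s.botE _).trans s', h', False.elim⟩
  | allI _ _ ih =>
    intro Δ σ τ hτ
    obtain ⟨_, s, h, -⟩ := ih _ _ _ (hτ.shift.up _)
    exact ⟨_, s.allI, .allI trivial h, False.elim⟩
  | @allE Γ A t p q k _ _ ih₁ ih₂ =>
    intro Δ σ τ hτ
    obtain ⟨⟨p', s₁, h₁, hne⟩, ⟨q', s₂, h₂, -⟩⟩ := ih₁ _ _ _ hτ, ih₂ _ _ _ hτ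
    obtain ⟨r, s', h', hr⟩ := h₁.exists_plug hn (.allE h₂)
      (by simpa [Fml.size_subst] using hne k)
    rw [Fml.inst_subst]
    refine ⟨r, (s₁.allE _ s₂).trans s', h', fun _ => hr.imp (fun e => by subst e; trivial) fun hr => ?_⟩
    simp only [Fml.size, Fml.size_subst] at hr
    rw [Fml.size_inst]
    omega
  | exI _ _ _ ih₁ ih₂ =>
    intro Δ σ τ hτ
    obtain ⟨⟨_, s₁, h₁, -⟩, ⟨_, s₂, h₂, -⟩⟩ := ih₁ _ _ _ hτ, ih₂ _ _ _ hτ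
    rw [Fml.inst_subst] at h₁
    exact ⟨_, s₁.exI _ _ s₂, .exI trivial h₁ h₂, False.elim⟩
  | exE k _ _ ih₁ ih₂ =>
    intro Δ σ τ hτ
    obtain ⟨⟨_, s₁, h₁, hne⟩, ⟨_, s₂, h₂, -⟩⟩ := ih₁ _ _ _ hτ, ih₂ _ _ _ ((hτ.shift.up _).up _)
    rw [Fml.shift_subst] at h₂
    obtain ⟨r, s', h', -⟩ := h₁.exists_plug hn (.exE h₂)
      (by simpa [Fml.size_subst] using hne k)
    exact ⟨r, (s₁.exE s₂).trans s', h', False.elim⟩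
  | eqI _ _ ih =>
    intro Δ σ τ hτ
    obtain ⟨_, s, h, -⟩ := ih _ _ _ hτ
    obtain ⟨r, s', h'⟩ := h.normalizes_plug hn (Nat.zero_le n) .eqI
    exact ⟨r, s.eqI.trans s', h', False.elim⟩
  | eqE k _ _ ih₁ ih₂ =>
    intro Δ σ τ hτ
    obtain ⟨⟨_, s₁, h₁, -⟩, ⟨_, s₂, h₂, -⟩⟩ := ih₁ _ _ _ hτ, ih₂ _ _ _ hτ
    rw [Fml.inst_subst] at h₂ ⊢
    obtain ⟨r, s', h'⟩ := NF.normalizes_eqE (k.1.subst _) h₁ h₂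
    exact ⟨r, (s₁.eqE _ _ _ s₂).trans s', h', False.elim⟩
  | @ad Γ A t p _ _ ht ih =>
    intro Δ σ τ hτ
    obtain ⟨_, s, h, -⟩ := ih _ _ _ hτ
    obtain ⟨r, s', h'⟩ := h.normalizes_plug hn (by cases ht <;> exact Nat.zero_le n)
      (.ad (ht.subst σ))
    exact ⟨r, (s.ad _ _).trans s', h', False.elim⟩

/-! ### Normalization of restricted deductions -/

theorem NF.normalizes_frame {Γ : List (Fml S)} {p F B C} (hp : NF Γ p B) (hF : NFFrame Γ F B C) :
    Normalizes Γ (F.plug p) C :=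
  hp.normalizes_plug (n := B.size) (fun m _ => substNormalizes m) le_rfl hF

theorem ProvesWith.normalizes {Γ : List (Fml S)} {p A} (h : ProvesWith LocalRestricted Γ p A) :
    Normalizes Γ p A := by
  induction h with
  | hyp i _ h => exact ⟨_, .refl, .hyp i trivial h⟩
  | andI _ _ _ ih₁ ih₂ =>
    obtain ⟨⟨_, s₁, h₁⟩, ⟨_, s₂, h₂⟩⟩ := ih₁, ih₂
    exact ⟨_, s₁.andI s₂, .andI trivial h₁ h₂⟩
  | andE₁ _ _ ih =>
    obtain ⟨_, s, h⟩ := ih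
    obtain ⟨r, s', h'⟩ := h.normalizes_frame .andE₁
    exact ⟨r, s.andE₁.trans s', h'⟩
  | andE₂ _ _ ih =>
    obtain ⟨_, s, h⟩ := ih
    obtain ⟨r, s', h'⟩ := h.normalizes_frame .andE₂
    exact ⟨r, s.andE₂.trans s', h'⟩
  | impI _ _ ih =>
    obtain ⟨_, s, h⟩ := ih
    exact ⟨_, s.impI _, .impI trivial h⟩
  | impE _ _ _ ih₁ ih₂ =>
    obtain ⟨⟨_, s₁, h₁⟩, ⟨_, s₂, h₂⟩⟩ := ih₁, ih₂
    obtain ⟨r, s', h'⟩ := h₁.normalizes_frame (.impE h₂)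
    exact ⟨r, (s₁.impE s₂).trans s', h'⟩
  | orI₁ _ _ ih =>
    obtain ⟨_, s, h⟩ := ih
    exact ⟨_, s.orI₁ _, .orI₁ trivial h⟩
  | orI₂ _ _ ih =>
    obtain ⟨_, s, h⟩ := ih
    exact ⟨_, s.orI₂ _, .orI₂ trivial h⟩
  | orE _ _ _ _ ih₁ ih₂ ih₃ =>
    obtain ⟨⟨_, s₁, h₁⟩, ⟨_, s₂, h₂⟩, ⟨_, s₃, h₃⟩⟩ := ih₁, ih₂, ih₃
    obtain ⟨r, s', h'⟩ := h₁.normalizes_frame (.orE h₂ h₃)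
    exact ⟨r, (s₁.orE s₂ s₃).trans s', h'⟩
  | botE k _ ih =>
    obtain ⟨_, s, h⟩ := ih
    obtain ⟨r, s', h'⟩ := h.normalizes_frame (.botE k)
    exact ⟨r, (s.botE _).trans s', h'⟩
  | allI _ _ ih =>
    obtain ⟨_, s, h⟩ := ih
    exact ⟨_, s.allI, .allI trivial h⟩
  | allE _ _ _ ih₁ ih₂ =>
    obtain ⟨⟨_, s₁, h₁⟩, ⟨_, s₂, h₂⟩⟩ := ih₁, ih₂
    obtain ⟨r, s', h'⟩ := h₁.normalizes_frame (.allE h₂)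
    exact ⟨r, (s₁.allE _ s₂).trans s', h'⟩
  | exI _ _ _ ih₁ ih₂ =>
    obtain ⟨⟨_, s₁, h₁⟩, ⟨_, s₂, h₂⟩⟩ := ih₁, ih₂
    exact ⟨_, s₁.exI _ _ s₂, .exI trivial h₁ h₂⟩
  | exE _ _ _ ih₁ ih₂ =>
    obtain ⟨⟨_, s₁, h₁⟩, ⟨_, s₂, h₂⟩⟩ := ih₁, ih₂
    obtain ⟨r, s', h'⟩ := h₁.normalizes_frame (.exE h₂)
    exact ⟨r, (s₁.exE s₂).trans s', h'⟩
  | eqI _ _ ih =>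
    obtain ⟨_, s, h⟩ := ih
    obtain ⟨r, s', h'⟩ := h.normalizes_frame .eqI
    exact ⟨r, s.eqI.trans s', h'⟩
  | eqE k _ _ ih₁ ih₂ =>
    obtain ⟨⟨_, s₁, h₁⟩, ⟨_, s₂, h₂⟩⟩ := ih₁, ih₂
    obtain ⟨r, s', h'⟩ := NF.normalizes_eqE k h₁ h₂
    exact ⟨r, (s₁.eqE _ _ _ s₂).trans s', h'⟩
  | ad _ _ ht ih =>
    obtain ⟨_, s, h⟩ := ih
    obtain ⟨r, s', h'⟩ := h.normalizes_frame (.ad ht)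
    exact ⟨r, (s.ad _ _).trans s', h'⟩

/-! ### Absence of maximal segments -/

theorem Pf.Sub.snoc {p q r : Pf S} {a : List ℕ} {i : ℕ} (h : p.Sub a q)
    (hi : p.Sub (a ++ [i]) r) : q.premises[i]? = some r := by
  induction h with
  | nil p =>
    cases hi with
    | cons hi h => cases h; exact hi
  | cons hj _ ih =>
    cases hi with
    | cons hj' h =>
      rw [hj] at hj'
      cases hj'
      exact ih h

theorem Pf.Sub.unique {p q r : Pf S} {a : List ℕ} (h : p.Sub a q) (h' : p.Sub a r) : q = r := by
  induction h with
  | nil p => cases h'; rfl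
  | cons hj _ ih =>
    cases h' with
    | cons hj' h' =>
      rw [hj] at hj'
      cases hj'
      exact ih h'

theorem PremOf.exists_sub {D : Pf S} {K : Pf S → Prop} {i : ℕ} {a b : List ℕ}
    (h : PremOf D K i a b) :
    ∃ p q, D.Sub b p ∧ D.Sub a q ∧ K p ∧ p.premises[i]? = some q := by
  obtain ⟨rfl, ⟨q, hq⟩, p, hp, hK⟩ := h
  exact ⟨p, q, hp, hq, hK, hp.snoc hq⟩

theorem IsSegment.eq_singleton {D : Pf S} {l : List (List ℕ)} {a b : List ℕ}
    (h : IsSegment D l a b) (hb : ¬ ConclOf D Pf.EndsOrEx b) : l = [b] ∧ a = b := by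
  rcases List.eq_nil_or_concat l with rfl | ⟨l', c, rfl⟩
  · exact absurd h.head (by simp)
  · obtain rfl : c = b := by simpa using h.last
    rcases List.eq_nil_or_concat l' with rfl | ⟨l'', d, rfl⟩
    · have := h.head
      simp_all
    · have hc := h.chain
      simp only [List.concat_eq_append, List.append_assoc, List.cons_append, List.nil_append,
        List.isChain_append, List.isChain_cons_cons] at hc
      obtain ⟨i, -, hp⟩ := hc.2.1.1
      exact absurd hp.2.2 hb

/-- In a normal deduction, the major premise of an elimination and the premise of `(=I)` or `(AD)`
are not concluded by `(∨E)` or `(∃E)`.  So segments that end there have length `1`. -/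
theorem NF.not_orEx_major {Γ : List (Fml S)} {p q A} (h : NF Γ p A)
    (hK : p.EndsElim ∨ p.EndsEqI ∨ p.EndsAD) (hq : p.premises[0]? = some q) :
    ¬ q.EndsOrEx ∧ (p.EndsElim → ¬ q.EndsIntro) := by
  have hl := h.local
  cases h with
  | hyp | andI | impI | orI₁ | orI₂ | allI | exI => rcases hK with h | h | h <;> cases h
  | andE₁ | andE₂ | impE | orE | allE | exE =>
    cases hq
    exact ⟨Pf.Neutral.not_orEx hl, fun _ => Pf.Neutral.not_intro hl⟩
  | botE =>
    cases hq
    exact ⟨hl.2.not_orEx, fun _ => hl.2.not_intro⟩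
  | eqI | ad =>
    cases hq
    exact ⟨hl.1, nofun⟩
  | @eqE _ A s t p _ _ hp _ =>
    cases hq
    refine ⟨hl.2.2.2, fun _ hi => ?_⟩
    -- an introduction that concludes an equation concludes `s = s`
    cases hi <;> cases hp
    exact hl.2.2.1 rfl

theorem NF.sub {Γ : List (Fml S)} {D p A a} (h : NF Γ D A) (hp : D.Sub a p) :
    ∃ Δ B, NF Δ p B :=
  ProvesWith.sub hp h

theorem NF.normal {Γ : List (Fml S)} {D A} (h : NF Γ D A) : Normal D where
  noMaxIE := by
    rintro ⟨l, a, b, hl, ⟨c, hc⟩, h₁⟩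
    obtain ⟨p, q, hp, hq, hK, hpq⟩ := hc.exists_sub
    obtain ⟨Δ, B, hΔ⟩ := h.sub hp
    have hm := hΔ.not_orEx_major (.inl hK) hpq
    obtain ⟨rfl, rfl⟩ := hl.eq_singleton fun ⟨r, hr, hr'⟩ => hm.1 (hq.unique hr ▸ hr')
    obtain ⟨r, hr, hr'⟩ := h₁ rfl
    exact hm.2 hK (hq.unique hr ▸ hr')
  noMaxEq := by
    rintro ⟨l, a, b, hl, ⟨r, hr, hr'⟩, c, hc⟩
    obtain ⟨p, q, hp, hq, hK, hpq⟩ := hc.exists_sub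
    obtain ⟨Δ, B, hΔ⟩ := h.sub hp
    have hm := hΔ.not_orEx_major (.inr (.inr hK)) hpq
    obtain ⟨rfl, rfl⟩ := hl.eq_singleton fun ⟨r, hr, hr'⟩ => hm.1 (hq.unique hr ▸ hr')
    obtain rfl := hq.unique hr
    cases hK
    cases hpq
    exact hΔ.local.2.1 hr'
  noMaxExi := by
    rintro ⟨l, a, b, hl, ⟨r, hr, hr'⟩, c, hc⟩
    obtain ⟨p, q, hp, hq, hK, hpq⟩ := hc.exists_sub
    obtain ⟨Δ, B, hΔ⟩ := h.sub hp
    have hm := hΔ.not_orEx_major (.inr (.inl hK)) hpq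
    obtain ⟨rfl, rfl⟩ := hl.eq_singleton fun ⟨r, hr, hr'⟩ => hm.1 (hq.unique hr ▸ hr')
    obtain rfl := hq.unique hr
    cases hK
    cases hpq
    exact hΔ.local.2 hr'
  noMaxEqE := by
    rintro ⟨L, hL, hmax⟩
    -- the last segment of an `(=E)`-segment begins with a conclusion of `(=E)`
    obtain ⟨l, a, A, s, t, p, q, hlL, hl, hla, ha⟩ : ∃ l a A s t p q, L.getLast? = some l ∧
        l ∈ L ∧ l.head? = some a ∧ D.Sub a (.eqE A s t p q) := by
      rcases List.eq_nil_or_concat L with rfl | ⟨L', l, rfl⟩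
      · exact absurd hL.length (by simp)
      · rcases List.eq_nil_or_concat L' with rfl | ⟨L'', l', rfl⟩
        · exact absurd hL.length (by simp)
        · have hc := hL.chain
          simp only [List.concat_eq_append, List.append_assoc, List.cons_append, List.nil_append,
            List.isChain_append, List.isChain_cons_cons] at hc
          obtain ⟨b, a, -, ha, hp⟩ := hc.2.1.1
          obtain ⟨r, hr, ⟨⟩⟩ := hp.2.2
          exact ⟨l, a, _, _, _, _, _, by simp, by simp, ha, hr⟩
    rcases hmax with ⟨l', b, c, hl', hb, hc⟩ | hexi
    · obtain rfl : l = l' := by rw [hlL] at hl'; exact Option.some.inj hl'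
      obtain ⟨a', b', hs⟩ := hL.seg l hl
      obtain rfl : b = b' := by have := hs.last; rw [hb] at this; exact Option.some.inj this
      obtain ⟨p', q', hp', hq', hK, hpq⟩ := hc.exists_sub
      obtain ⟨Δ, B, hΔ⟩ := h.sub hp'
      have hm := hΔ.not_orEx_major (.inr (.inr hK)) hpq
      obtain ⟨rfl, -⟩ := hs.eq_singleton fun ⟨r, hr, hr'⟩ => hm.1 (hq'.unique hr ▸ hr')
      obtain rfl : b = a := by simpa using hla
      obtain rfl := hq'.unique ha
      cases hK
      cases hpq
      exact hΔ.local.2.2 (.eqE _ _ _ _ _)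
    · obtain ⟨-, w, hw⟩ := hexi l hl a hla A s t p q ha
      obtain ⟨Δ, B, hΔ⟩ := h.sub ha
      exact Fml.subst_ne_exi hΔ.local.2.1 _ w hw

theorem NF.noVacuousEqE {Γ : List (Fml S)} {D A} (h : NF Γ D A) : NoVacuousEqE D := by
  intro a B s t p q hs
  obtain ⟨Δ, C, hΔ⟩ := h.sub hs
  have hne := hΔ.local.2.2.1
  exact ⟨fun e => hne (e ▸ rfl), hne⟩

end INF

theorem mainTheorem1 (S : INF.Sig.{u, v}) (Γ : List (INF.Fml S)) (A : INF.Fml S)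
    (D : INF.Pf S) (hD : INF.Proves Γ D A) :
    ∃ D₀ D' : INF.Pf S,
      INF.RestrictsTo D D₀ ∧ INF.Proves Γ D₀ A ∧ INF.Restricted D₀ ∧
      INF.ReducesTo D₀ D' ∧ INF.Proves Γ D' A ∧ INF.Restricted D' ∧
      INF.NoVacuousEqE D' ∧ INF.Normal D' := by
  obtain ⟨D₀, hs₀, h₀⟩ := hD.exists_restricted
  obtain ⟨D', hs, h⟩ := h₀.normalizes
  exact ⟨D₀, D', hs₀, h₀.proves, h₀.restricted, hs, h.proves,
    (h.mono INF.LocalNormal.restricted).restricted, INF.NF.noVacuousEqE h, INF.NF.normal h⟩
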